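/- **Conventions.** Let $L$ be a first-order signature with equality. All $L$-structures are non-empty. *Positive formulas* are built from atomic formulas using $\wedge,\vee,\top,\bot,\exists$. A *positive theory* $T$ is a set of sentences $\forall x(\varphi(x)\to\psi(x))$ with $\varphi,\psi$ positive. We write $|T|=|L|+\aleph_0$ for the number of $L$-formulas, and $\lambda_T=\beth_{(2^{|T|})^+}$. An *immersion* is a homomorphism that preserves and reflects all positive formulas. A *pec model* of $T$ is a model $M\models T$ such that every homomorphism from $M$ to a model of $T$ is an immersion. $T$ has the *joint continuation property* (JCP) if any two models of $T$ map homomorphically to a common model of $T$. A pec model $N$ is *$\kappa$-saturated* if every set of positive formulas in a finite tuple of variables, with parameters from a subset of $N$ of cardinality $<\kappa$, is satisfiable in $N$ as soon as it is finitely satisfiable in $N$. Indiscernibility is meant with respect to positive formulas. $T$ is *thick* if for each $n$ there is a set $\Theta$ of positive formulas without parameters such that a sequence $(a_i)_{i<\omega}$ of $n$-tuples from a pec model of $T$ is indiscernible if and only if it satisfies $\Theta$. $T$ is *NIP* if there are no positive formulas $\varphi(x;y),\psi(x;y)$ (with $x,y$ finite tuples of variables) with $T\models\forall x,y\,\neg(\varphi\wedge\psi)$,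 model $A\models T$ and tuples $(a_i)_{i\in\omega}$, $(b_W)_{W\subseteq\omega}$ in $A$ such that $A\models\varphi(a_i;b_W)$ whenever $i\in W$ and $A\models\psi(a_i;b_W)$ whenever $i\notin W$. Fix a cardinal $\bar\kappa>2^{\lambda_T}$ and a *monster model* $\mathfrak U$ of $T$, that is, a $\bar\kappa$-saturated pec model of $T$ in which every partial map with domain of cardinality $<\bar\kappa$ that preserves and reflects positive formulas extends to an automorphism. For a pec model $N$ of $T$, $S(N)$ denotes the set of maximal types over $N$ in finite tuples of variables, that is, the maximal sets of positive formulas over $N$ that are realised in some model of $T$ to which $N$ maps homomorphically. A formula over $N$ *follows* from $p\in S(N)$, written $p\vdash$, if it holds of every such realisation of $p$. A *global* type is an element of $S(\mathfrak U)$; it extends $p\in S(M)$, for $M\subseteq\mathfrak U$, if it contains $p$. A global type $q(x)$ is *$M$-invariant* if for all positive $\varphi(x;y)$ and all finite tuples $a,a'$ of $\mathfrak U$ with the same positive type over $M$ we have $q\vdash\varphi(x;a)\iff q\vdash\varphi(x;a')$. It is a *negative coheir over $M$* if for every positive formula $\varphi(x)$ over $\mathfrak U$ such that $\neg\varphi(x)$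 follows from $q(x)$, the formula $\neg\varphi(x)$ is satisfied in $\mathfrak U$ by a tuple from $M$. **Statement.** Let $T$ be a thick positive theory with JCP, and let $\bar\kappa$ and $\mathfrak U$ be as above. The following are equivalent. 1. $T$ is NIP. 2. For every pec model $M\models T$ that is a substructure of $\mathfrak U$ with $|M|<\bar\kappa$, every $p\in S(M)$ has at most $2^{|M|+|T|}$ global $M$-invariant extensions. 3. For every $\lambda_T$-saturated pec model $M\models T$ that is a substructure of $\mathfrak U$ with $|M|<\bar\kappa$, every $p\in S(M)$ has at most $2^{|M|+|T|}$ global negative coheir extensions. -/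

import Mathlib

open FirstOrder

universe u

namespace PositiveLogic

open FirstOrder.Language Cardinal

variable {L : FirstOrder.Language.{u, u}}

/-! ### Positive syntax -/

/-- Positive formulas: built from atomic formulas (equality included) using
`⊥`, `⊤`, `∧`, `∨` and `∃`. -/
inductive IsPositive {α : Type*} : ∀ {n : ℕ}, L.BoundedFormula α n → Prop
  | bot {n : ℕ} : IsPositive (⊥ : L.BoundedFormula α n)
  | top {n : ℕ} : IsPositive (⊤ : L.BoundedFormula α n)
  | atomic {n : ℕ} {φ : L.BoundedFormula α n} (h : φ.IsAtomic) : IsPositive φ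
  | inf {n : ℕ} {φ ψ : L.BoundedFormula α n} (hφ : IsPositive φ) (hψ : IsPositive ψ) :
      IsPositive (φ ⊓ ψ)
  | sup {n : ℕ} {φ ψ : L.BoundedFormula α n} (hφ : IsPositive φ) (hψ : IsPositive ψ) :
      IsPositive (φ ⊔ ψ)
  | ex {n : ℕ} {φ : L.BoundedFormula α (n + 1)} (hφ : IsPositive φ) : IsPositive φ.ex

/-- A positive theory is a set of h-inductive sentences `∀ x, (φ(x) → ψ(x))` with `φ`, `ψ`
positive. -/
def IsPositiveTheory (T : L.Theory) : Prop :=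
  ∀ σ ∈ T, ∃ (n : ℕ) (φ ψ : L.BoundedFormula Empty n),
    IsPositive φ ∧ IsPositive ψ ∧ σ = (φ.imp ψ).alls

/-- `|T|`, the cardinality of the set of formulas in the language of `T`, that is `|L| + ℵ₀`. -/
noncomputable def theoryCard (_T : L.Theory) : Cardinal.{u} := max ℵ₀ L.card

/-- `λ_T`, the beth number indexed by the cardinal successor of `2 ^ |T|`. -/
noncomputable def lambdaT (T : L.Theory) : Cardinal.{u} :=
  Cardinal.beth (Order.succ ((2 : Cardinal.{u}) ^ theoryCard T)).ord

/-! ### Positively existentially closed models, joint continuation, saturation -/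

/-- A homomorphism is an immersion if it preserves and reflects all positive formulas. -/
def IsImmersion {A B : Type u} [L.Structure A] [L.Structure B] (f : A →[L] B) : Prop :=
  ∀ (n : ℕ) (φ : L.Formula (Fin n)), IsPositive φ →
    ∀ a : Fin n → A, φ.Realize (f ∘ a) ↔ φ.Realize a

/-- `M` is a positively existentially closed (pec) model of `T`: it is a model of `T`, and every
homomorphism from `M` to a model of `T` is an immersion. -/
def IsPec (T : L.Theory) (M : Type u) [L.Structure M] : Prop :=
  M ⊨ T ∧ ∀ (A : Theory.ModelType.{u, u, u} T) (f : M →[L] A), IsImmersion f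

/-- The joint continuation property. -/
def HasJCP (T : L.Theory) : Prop :=
  ∀ A₁ A₂ : Theory.ModelType.{u, u, u} T, ∃ B : Theory.ModelType.{u, u, u} T,
    Nonempty (A₁ →[L] B) ∧ Nonempty (A₂ →[L] B)

/-- `N` is `κ`-saturated: every set of positive formulas over a subset of `N` of size `< κ`
which is finitely satisfiable in `N` is satisfiable in `N`. -/
def IsSaturated (L : FirstOrder.Language.{u, u}) (κ : Cardinal.{u}) (N : Type u) [L.Structure N] : Prop :=
  ∀ A : Set N, #A < κ → ∀ (n : ℕ) (S : Set (L.Formula (A ⊕ Fin n))), (∀ φ ∈ S, IsPositive φ) →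
    (∀ S₀ : Finset (L.Formula (A ⊕ Fin n)), (S₀ : Set (L.Formula (A ⊕ Fin n))) ⊆ S →
      ∃ x : Fin n → N, ∀ φ ∈ S₀, φ.Realize (Sum.elim (fun a : A => (a : N)) x)) →
    ∃ x : Fin n → N, ∀ φ ∈ S, φ.Realize (Sum.elim (fun a : A => (a : N)) x)

/-- Every partial immersion from `N` to `N` with domain of size `< κ` extends to an
automorphism of `N`. -/
def IsHomogeneous (L : FirstOrder.Language.{u, u}) (κ : Cardinal.{u}) (N : Type u) [L.Structure N] : Prop :=
  ∀ (A : Set N) (f : A → N), #A < κ →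
    (∀ (n : ℕ) (φ : L.Formula (Fin n)), IsPositive φ → ∀ a : Fin n → A,
      φ.Realize (fun i => f (a i)) ↔ φ.Realize (fun i => (a i : N))) →
    ∃ g : N ≃[L] N, ∀ a : A, g a = f a

/-- `U` is a monster model of `T`, where "small" means "of cardinality `< κ`". -/
structure IsMonster (T : L.Theory) (κ : Cardinal.{u}) (U : Type u) [L.Structure U] : Prop where
  pec : IsPec T U
  homogeneous : IsHomogeneous L κ U
  saturated : IsSaturated L κ U

/-! ### Thickness and NIP -/

/-- A sequence of `n`-tuples is indiscernible (with respect to positive formulas). -/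
def IsIndiscernible (L : FirstOrder.Language.{u, u}) {N : Type u} [L.Structure N] {n : ℕ}
    (a : ℕ → Fin n → N) : Prop :=
  ∀ (k : ℕ) (i j : Fin k → ℕ), StrictMono i → StrictMono j →
    ∀ φ : L.Formula (Fin k × Fin n), IsPositive φ →
      (φ.Realize (fun v => a (i v.1) v.2) ↔ φ.Realize (fun v => a (j v.1) v.2))

/-- `T` is thick: in pec models, being an indiscernible sequence of `n`-tuples is type-definable
(by a set of positive formulas without parameters). -/
def IsThick (T : L.Theory) : Prop :=
  ∀ n : ℕ, ∃ Θ : Set (L.Formula (ℕ × Fin n)), (∀ φ ∈ Θ, IsPositive φ) ∧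
    ∀ N : Theory.ModelType.{u, u, u} T, IsPec T N → ∀ a : ℕ → Fin n → N,
      (IsIndiscernible L a ↔ ∀ φ ∈ Θ, φ.Realize (fun v => a v.1 v.2))

/-- The formula `φ(x; y)` has the independence property modulo `T`. -/
def HasIP (T : L.Theory) {n k : ℕ} (φ : L.Formula (Fin n ⊕ Fin k)) : Prop :=
  ∃ ψ : L.Formula (Fin n ⊕ Fin k), IsPositive ψ ∧
    (∀ (A : Theory.ModelType.{u, u, u} T) (x : Fin n → A) (y : Fin k → A),
      ¬ (φ.Realize (Sum.elim x y) ∧ ψ.Realize (Sum.elim x y))) ∧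
    ∃ (A : Theory.ModelType.{u, u, u} T) (a : ℕ → Fin n → A) (b : Set ℕ → Fin k → A),
      ∀ (i : ℕ) (W : Set ℕ),
        (i ∈ W → φ.Realize (Sum.elim (a i) (b W))) ∧
        (i ∉ W → ψ.Realize (Sum.elim (a i) (b W)))

/-- `T` is NIP: no positive formula has the independence property. -/
def IsNIP (T : L.Theory) : Prop :=
  ∀ (n k : ℕ) (φ : L.Formula (Fin n ⊕ Fin k)), IsPositive φ → ¬ HasIP T φ

/-! ### Types -/

/-- The `n`-tuple `a` of the continuation `f : N → A` realises the set `p` of formulas with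
parameters from `N`. -/
def Realizes {N A : Type u} [L.Structure N] [L.Structure A] {n : ℕ} (f : N →[L] A)
    (a : Fin n → A) (p : Set (L.Formula (N ⊕ Fin n))) : Prop :=
  ∀ φ ∈ p, φ.Realize (Sum.elim f a)

/-- Partial `n`-types over `N`: sets of positive formulas over `N` which are realised in some model
of `T` continuing `N`. -/
def IsPartialType (T : L.Theory) (N : Type u) [L.Structure N] {n : ℕ}
    (p : Set (L.Formula (N ⊕ Fin n))) : Prop :=
  (∀ φ ∈ p, IsPositive φ) ∧
    ∃ (A : Theory.ModelType.{u, u, u} T) (f : N →[L] A) (a : Fin n → A), Realizes f a p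

/-- `S_n(N)`: the maximal `n`-types over `N`. -/
def MaximalTypes (T : L.Theory) (N : Type u) [L.Structure N] (n : ℕ) :
    Set (Set (L.Formula (N ⊕ Fin n))) :=
  {p | Maximal (IsPartialType T N) p}

/-- The formula `φ` with parameters from `N` follows from `p`: it is true of every realisation
of `p` in a model of `T` continuing `N`. -/
def Entails (T : L.Theory) {N : Type u} [L.Structure N] {n : ℕ}
    (p : Set (L.Formula (N ⊕ Fin n))) (φ : L.Formula (N ⊕ Fin n)) : Prop :=
  ∀ (A : Theory.ModelType.{u, u, u} T) (f : N →[L] A) (a : Fin n → A),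
    Realizes f a p → φ.Realize (Sum.elim f a)

variable {U : Type u} [L.Structure U]

/-- A type over `U` extends a type over `M ⊆ U`. -/
def Extends {M : L.Substructure U} {n : ℕ} (q : Set (L.Formula (U ⊕ Fin n)))
    (p : Set (L.Formula (M ⊕ Fin n))) : Prop :=
  ∀ φ ∈ p, φ.relabel (Sum.map (fun m : M => (m : U)) id) ∈ q

/-- `a ≡_M a'`: the tuples `a`, `a'` of `U` have the same positive type over `M`. -/
def SameType (M : L.Substructure U) {k : ℕ} (a a' : Fin k → U) : Prop :=
  ∀ φ : L.Formula (M ⊕ Fin k), IsPositive φ →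
    (φ.Realize (Sum.elim (fun m : M => (m : U)) a) ↔
      φ.Realize (Sum.elim (fun m : M => (m : U)) a'))

/-- For a formula `φ(x; y)` and a tuple `a` of parameters, the formula `φ(x; a)`. -/
def plug {n k : ℕ} (φ : L.Formula (Fin n ⊕ Fin k)) (a : Fin k → U) : L.Formula (U ⊕ Fin n) :=
  φ.relabel (Sum.elim (fun i => Sum.inr i) (fun j => Sum.inl (a j)))

/-- The global type `p(x)` is `M`-invariant: if `a ≡_M a'` then
`p(x) ⊢ φ(x; a) ↔ p(x) ⊢ φ(x; a')` for all positive `φ(x; y)`. -/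
def IsInvariant (T : L.Theory) (M : L.Substructure U) {n : ℕ}
    (p : Set (L.Formula (U ⊕ Fin n))) : Prop :=
  ∀ (k : ℕ) (a a' : Fin k → U), SameType M a a' →
    ∀ φ : L.Formula (Fin n ⊕ Fin k), IsPositive φ →
      (Entails T p (plug φ a) ↔ Entails T p (plug φ a'))

/-- The global type `p(x)` is a negative coheir over `M`: for every positive `φ(x)` over `U`, if
`¬ φ(x)` follows from `p(x)`, then `¬ φ(x)` has a realisation in `M`. -/
def IsNegativeCoheir (T : L.Theory) (M : L.Substructure U) {n : ℕ}
    (p : Set (L.Formula (U ⊕ Fin n))) : Prop :=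
  ∀ φ : L.Formula (U ⊕ Fin n), IsPositive φ → Entails T p φ.not →
    ∃ m : Fin n → M, ¬ φ.Realize (Sum.elim id (fun i => (m i : U)))

/-- The global `M`-invariant (maximal) extensions of `p`. -/
def invariantExtensions (T : L.Theory) (M : L.Substructure U) {n : ℕ}
    (p : Set (L.Formula (M ⊕ Fin n))) : Set (Set (L.Formula (U ⊕ Fin n))) :=
  {q | q ∈ MaximalTypes T U n ∧ Extends q p ∧ IsInvariant T M q}

/-- The global negative coheir (maximal) extensions of `p`. -/
def negativeCoheirExtensions (T : L.Theory) (M : L.Substructure U) {n : ℕ}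
    (p : Set (L.Formula (M ⊕ Fin n))) : Set (Set (L.Formula (U ⊕ Fin n))) :=
  {q | q ∈ MaximalTypes T U n ∧ Extends q p ∧ IsNegativeCoheir T M q}

end PositiveLogic

namespace PositiveLogic

open FirstOrder.Language Cardinal

/-! ### Syntactic closure properties of positive formulas -/

section PositiveFormulas

variable {L : FirstOrder.Language.{u, u}} {α β γ : Type*}

/-! Positive logic has no negation, and maximality replaces it: in a pec model, a positive formula
that fails at a tuple is refuted by a positive formula holding there, so distinct global types are
separated by a contradictory pair `φ`, `ψ` (`IsPec.isMaxTuple`, `MaximalTypes.exists_separation`).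

NIP bounds invariant extensions because an invariant type is determined by the type over `M` of one
of its Morley sequences. If two different invariant types had Morley sequences of the same type over
`M`, one could realise them alternately over `M` and the parameters of a separating pair. By
invariance the mixed sequence looks like the pure one over `M` (`sameTypeOver_of_morley`), yet it
satisfies `φ` and `ψ` alternately, and its subsequences give every pattern of independence
(`IsNIP.eq_of_sameTypeOver`). There are only `2 ^ (|M| + |T|)` types over `M` in countably many
variables.

Invariant extensions bound negative coheirs because, in a thick theory, a negative coheir over a
`λ_T`-saturated pec model is invariant (`IsNegativeCoheir.isInvariant`). If `a` and `a'` have the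
same type over `M` and `x` realises the coheir, it is enough that `(x, a)` and `(x, a')` are second
members of indiscernible sequences with a common first member. By thickness and saturation this
reduces to finitely many positive conditions; if one failed, it would fail for some `m` in `M`. For
`m` in `M` it holds: copy `a` into `M` along a sequence of length `λ_T`, extract an indiscernible
sequence by Erdős–Rado, and exchange the later copy for `a` and then for `a'`.

Conversely, the independence property on an index set `J` of size `2 ^ λ_T`, realised by tuples of a
saturated `M` of size at most `|J|`, yields too many coheirs. Ultrafilters on `J` induce negative
coheirs, and an independent family of subsets of `J` makes `2 ^ 2 ^ |J|` of them distinct, while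
there are at most `2 ^ |J|` types over `M`, each with at most `2 ^ |J|` coheir extensions by
assumption. -/

theorem IsPositive.bounded_relabel {m n : ℕ} {φ : L.BoundedFormula α n} (h : IsPositive φ)
    (g : α → β ⊕ Fin m) : IsPositive (φ.relabel g) := by
  induction h with
  | bot => exact .bot
  | top => exact .top
  | atomic h => exact .atomic (h.relabel g)
  | inf _ _ ih₁ ih₂ => exact .inf ih₁ ih₂
  | sup _ _ ih₁ ih₂ => exact .sup ih₁ ih₂
  | ex _ ih => rw [BoundedFormula.relabel_ex]; exact .ex ih

theorem IsPositive.relabel {φ : L.Formula α} (h : IsPositive φ) (g : α → β) :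
    IsPositive (φ.relabel g) :=
  h.bounded_relabel _

theorem IsPositive.restrictFreeVar [DecidableEq α] {n : ℕ} {φ : L.BoundedFormula α n}
    (h : IsPositive φ) (f : φ.freeVarFinset → β) : IsPositive (φ.restrictFreeVar f) := by
  induction h with
  | bot => exact .bot
  | top => exact .top
  | atomic h => cases h with
    | equal => exact .atomic (.equal _ _)
    | rel => exact .atomic (.rel _ _)
  | inf _ _ ih₁ ih₂ => exact .inf (ih₁ _) (ih₂ _)
  | sup _ _ ih₁ ih₂ => exact .sup (ih₁ _) (ih₂ _)
  | ex _ ih => exact .ex (ih _)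

theorem IsPositive.exs {n : ℕ} {φ : L.BoundedFormula α n} (h : IsPositive φ) :
    IsPositive φ.exs := by
  induction n with
  | zero => exact h
  | succ n ih => exact ih (.ex h)

theorem IsPositive.iExs [Finite β] {φ : L.Formula (α ⊕ β)} (h : IsPositive φ) :
    IsPositive (φ.iExs β) :=
  (h.bounded_relabel _).exs

theorem IsPositive.equal (s t : L.Term α) : IsPositive (s.equal t) :=
  .atomic (.equal _ _)

/-- A finite set of positive formulas has a positive conjunction. -/
theorem exists_conj (s : Finset (L.Formula α)) (hs : ∀ φ ∈ s, IsPositive φ) :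
    ∃ ψ : L.Formula α, IsPositive ψ ∧ ∀ (A : Type u) [L.Structure A] (v : α → A),
      ψ.Realize v ↔ ∀ φ ∈ s, φ.Realize v := by
  classical
  induction s using Finset.induction_on with
  | empty => exact ⟨⊤, .top, fun A _ v => by simp⟩
  | insert φ s _ ih =>
    obtain ⟨ψ, hψ, h⟩ := ih fun χ hχ => hs χ (Finset.mem_insert_of_mem hχ)
    refine ⟨φ ⊓ ψ, .inf (hs φ (Finset.mem_insert_self _ _)) hψ, fun A _ v => ?_⟩
    simp [h]

/-- A positive formula only depends on a finite tuple of the variables of its second sort. -/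
theorem exists_fin_support (φ : L.Formula (γ ⊕ β)) (hφ : IsPositive φ) :
    ∃ (k : ℕ) (j : Fin k → β) (ρ : L.Formula (γ ⊕ Fin k)), IsPositive ρ ∧
      ∀ (A : Type u) [L.Structure A] (v : γ → A) (w : β → A),
        φ.Realize (Sum.elim v w) ↔ ρ.Realize (Sum.elim v (w ∘ j)) := by
  classical
  let s : Set β := {b | Sum.inr b ∈ φ.freeVarFinset}
  have hs : s.Finite := φ.freeVarFinset.finite_toSet.preimage Sum.inr_injective.injOn
  obtain ⟨k, ⟨e⟩⟩ := @Finite.exists_equiv_fin s hs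
  let f : φ.freeVarFinset → γ ⊕ Fin k := fun a => match a with
    | ⟨Sum.inl c, _⟩ => Sum.inl c
    | ⟨Sum.inr b, hb⟩ => Sum.inr (e ⟨b, hb⟩)
  refine ⟨k, fun i => (e.symm i : β), φ.restrictFreeVar f, hφ.restrictFreeVar f,
    fun A _ v w => ?_⟩
  refine (BoundedFormula.realize_restrictFreeVar _ ?_).symm
  rintro ⟨c | b, h⟩ <;> simp [f]

theorem exists_fin_support' (φ : L.Formula β) (hφ : IsPositive φ) :
    ∃ (k : ℕ) (j : Fin k → β) (ρ : L.Formula (Fin k)), IsPositive ρ ∧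
      ∀ (A : Type u) [L.Structure A] (w : β → A), φ.Realize w ↔ ρ.Realize (w ∘ j) := by
  obtain ⟨k, j, ρ, hρ, h⟩ := exists_fin_support (γ := Empty) (φ.relabel Sum.inr) (hφ.relabel _)
  refine ⟨k, j, ρ.relabel (Sum.elim Empty.elim id), hρ.relabel _, fun A _ w => ?_⟩
  have := h A Empty.elim w
  rw [Formula.realize_relabel, Sum.elim_comp_inr] at this
  rw [this, Formula.realize_relabel]
  refine iff_of_eq (congrArg _ ?_)
  ext (i | i)
  · exact i.elim
  · rfl

/-- Existential projection of a positive formula along a map of variables. -/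
theorem exists_project [Finite β] (g : β → α) (χ : L.Formula α) (hχ : IsPositive χ) :
    ∃ E : L.Formula β, IsPositive E ∧ ∀ (A : Type u) [L.Structure A] [Nonempty A] (w : β → A),
      E.Realize w ↔ ∃ u : α → A, u ∘ g = w ∧ χ.Realize u := by
  classical
  have := Fintype.ofFinite β
  -- Only the finitely many variables occurring in `χ` or in the image of `g` are quantified; any
  -- other variable may take an arbitrary value.
  let t : Finset α := χ.freeVarFinset ∪ Finset.univ.image g
  have hg (b : β) : g b ∈ t := by simp [t]
  let ρ : L.Formula (β ⊕ t) :=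
    χ.restrictFreeVar fun a => Sum.inr ⟨a, Finset.mem_union_left _ a.2⟩
  let eqs : Finset (L.Formula (β ⊕ t)) := Finset.univ.image fun b =>
    (Term.var (Sum.inl b)).equal (Term.var (Sum.inr ⟨g b, hg b⟩))
  obtain ⟨ε, hε, hε'⟩ := exists_conj eqs (by simp [eqs, IsPositive.equal])
  refine ⟨(ρ ⊓ ε).iExs t, (IsPositive.inf (hχ.restrictFreeVar _) hε).iExs, fun A _ _ w => ?_⟩
  have hρ (u : α → A) : ρ.Realize (Sum.elim w fun a : t => u a) ↔ χ.Realize u :=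
    BoundedFormula.realize_restrictFreeVar _ (fun a => rfl)
  simp only [Formula.realize_iExs, Formula.realize_inf, hε']
  constructor
  · rintro ⟨x, hx, hx'⟩
    let u : α → A := fun a => if h : a ∈ t then x ⟨a, h⟩ else Classical.arbitrary A
    have hu : x = fun a : t => u a := by ext a; simp [u]
    refine ⟨u, ?_, ?_⟩
    · ext b
      have := hx' _ (Finset.mem_image_of_mem _ (Finset.mem_univ b))
      simp only [Formula.realize_equal, Term.realize_var, Sum.elim_inl, Sum.elim_inr] at this
      simp [u, hg, this]
    · rw [← hρ, ← hu]; exact hx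
  · rintro ⟨u, rfl, hu⟩
    refine ⟨fun a => u a, (hρ u).2 hu, ?_⟩
    simp [eqs]

/-- Homomorphisms preserve positive formulas. -/
theorem IsPositive.realize_hom {A B : Type*} [L.Structure A] [L.Structure B] {n : ℕ}
    {φ : L.BoundedFormula α n} (h : IsPositive φ) (f : A →[L] B) {v : α → A} {xs : Fin n → A}
    (hv : φ.Realize v xs) : φ.Realize (f ∘ v) (f ∘ xs) := by
  induction h with
  | bot => exact hv
  | top => simp
  | atomic h => cases h with
    | equal t₁ t₂ =>
      rw [BoundedFormula.realize_bdEqual] at hv ⊢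
      rw [← Sum.comp_elim, HomClass.realize_term, HomClass.realize_term, hv]
    | rel R ts =>
      rw [BoundedFormula.realize_rel] at hv ⊢
      have := f.map_rel R _ hv
      convert this using 1
      ext i
      simp [← Sum.comp_elim, HomClass.realize_term]
  | inf _ _ ih₁ ih₂ =>
    rw [BoundedFormula.realize_inf] at hv ⊢
    exact ⟨ih₁ hv.1, ih₂ hv.2⟩
  | sup _ _ ih₁ ih₂ =>
    rw [BoundedFormula.realize_sup] at hv ⊢
    exact hv.imp ih₁ ih₂
  | ex _ ih =>
    rw [BoundedFormula.realize_ex] at hv ⊢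
    obtain ⟨a, ha⟩ := hv
    exact ⟨f a, by simpa [Fin.comp_snoc] using ih ha⟩

theorem IsPositive.realize_formula_hom {A B : Type*} [L.Structure A] [L.Structure B]
    {φ : L.Formula α} (h : IsPositive φ) (f : A →[L] B) {v : α → A} (hv : φ.Realize v) :
    φ.Realize (f ∘ v) := by
  have := IsPositive.realize_hom h f hv
  rwa [Formula.Realize, Subsingleton.elim default (f ∘ default)]

/-- A map preserving positive formulas is a homomorphism. -/
theorem exists_hom_of_preserves {A : Type u} {B : Type*} [L.Structure A] [L.Structure B]
    (g : A → B) (h : ∀ φ : L.Formula A, IsPositive φ → φ.Realize id → φ.Realize g) :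
    ∃ f : A →[L] B, ⇑f = g := by
  refine ⟨⟨g, ?_, ?_⟩, rfl⟩
  · intro n F x
    have := h ((Term.var (Structure.funMap F x)).equal (Term.func F fun i => Term.var (x i)))
      (.equal _ _) (by simp)
    simpa [Function.comp_def] using this
  · intro n R x hx
    have := h (R.formula fun i => Term.var (x i)) (.atomic (.rel _ _))
      (by simpa [Formula.realize_rel] using hx)
    simpa [Formula.realize_rel, Function.comp_def] using this

end PositiveFormulas

/-! ### Compactness -/

section Compactness

variable {L : FirstOrder.Language.{u, u}} {T : L.Theory} {α : Type u}

/-- A set of formulas realised in some model of `T`. -/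
def Consistent (T : L.Theory) (Γ : Set (L.Formula α)) : Prop :=
  ∃ (A : Theory.ModelType.{u, u, u} T) (v : α → A), ∀ φ ∈ Γ, φ.Realize v

/-- Compactness, by an ultraproduct of models indexed by the finite subsets of `Γ`: each formula of
`Γ` holds in all models from some index on. -/
theorem consistent_of_finite {Γ : Set (L.Formula α)}
    (h : ∀ s : Finset (L.Formula α), (s : Set (L.Formula α)) ⊆ Γ →
      Consistent T (s : Set (L.Formula α))) :
    Consistent T Γ := by
  classical
  choose A v hv using fun s : Finset Γ => h (s.map (Function.Embedding.subtype _)) (by simp)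
  let 𝓤 : Ultrafilter (Finset Γ) := Ultrafilter.of Filter.atTop
  let P := (𝓤 : Filter (Finset Γ)).Product fun s => (A s : Type u)
  have hP : P ⊨ T := by
    refine (Theory.model_iff _).2 fun σ hσ => ?_
    rw [Ultraproduct.sentence_realize]
    exact .of_forall fun s => Theory.realize_sentence_of_mem T hσ
  refine ⟨Theory.ModelType.of T P, fun i => ((fun s => v s i : (s : Finset Γ) → A s) : P),
    fun φ hφ => ?_⟩
  refine (Ultraproduct.realize_formula_cast φ fun i s => v s i).2 ?_
  refine (Filter.Eventually.filter_mono (Ultrafilter.of_le _)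
    (Filter.eventually_ge_atTop {⟨φ, hφ⟩})).mono fun s hs => ?_
  refine hv s φ ?_
  simpa [hφ] using hs

end Compactness

/-! ### Maximal tuples -/

section MaxTuple

variable {L : FirstOrder.Language.{u, u}} {T : L.Theory} {α β : Type*}

/-- Positive formulas that are never satisfied simultaneously in a model of `T`. -/
def Contradictory (T : L.Theory) (φ ψ : L.Formula α) : Prop :=
  ∀ (A : Theory.ModelType.{u, u, u} T) (v : α → A), φ.Realize v → ¬ ψ.Realize v

/-- A tuple whose positive type is maximal: each positive formula failing at the tuple is refuted
by a positive formula holding at it. -/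
def IsMaxTuple (T : L.Theory) {A : Type u} [L.Structure A] (v : α → A) : Prop :=
  ∀ (k : ℕ) (j : Fin k → α) (φ : L.Formula (Fin k)), IsPositive φ → ¬ φ.Realize (v ∘ j) →
    ∃ ψ : L.Formula (Fin k), IsPositive ψ ∧ ψ.Realize (v ∘ j) ∧ Contradictory T φ ψ

variable {A : Type u} [L.Structure A]

theorem IsMaxTuple.comp {v : α → A} (h : IsMaxTuple T v) (g : β → α) : IsMaxTuple T (v ∘ g) :=
  fun k j φ hφ hn => h k (g ∘ j) φ hφ hn

theorem IsMaxTuple.separate {v : α → A} (h : IsMaxTuple T v) {φ : L.Formula α}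
    (hφ : IsPositive φ) (hn : ¬ φ.Realize v) :
    ∃ ψ : L.Formula α, IsPositive ψ ∧ ψ.Realize v ∧ Contradictory T φ ψ := by
  obtain ⟨k, j, ρ, hρ, hρφ⟩ := exists_fin_support' φ hφ
  obtain ⟨ψ, hψ, hψv, hc⟩ := h k j ρ hρ (by rwa [← hρφ])
  refine ⟨ψ.relabel j, hψ.relabel _, by simpa using hψv, fun B w hw hw' => ?_⟩
  exact hc B (w ∘ j) ((hρφ _ _).1 hw) (by simpa using hw')

/-- A maximal tuple has the same positive type as any tuple satisfying its positive type. -/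
theorem IsMaxTuple.realize_iff {v : α → A} (h : IsMaxTuple T v) {B : Type u} [L.Structure B]
    [B ⊨ T] [Nonempty B] {w : α → B}
    (hvw : ∀ φ : L.Formula α, IsPositive φ → φ.Realize v → φ.Realize w) {φ : L.Formula α}
    (hφ : IsPositive φ) : φ.Realize v ↔ φ.Realize w := by
  refine ⟨hvw φ hφ, fun hw => by_contra fun hn => ?_⟩
  obtain ⟨ψ, hψ, hψv, hc⟩ := h.separate hφ hn
  exact hc (Theory.ModelType.of T B) w hw (hvw ψ hψ hψv)

end MaxTuple

/-! ### Maximal types and their realisations -/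

section Maximality

variable {L : FirstOrder.Language.{u, u}} {T : L.Theory} {α : Type u}

/-- If no positive formula true at `v ∘ j` contradicts `φ`, then `φ` is compatible with the
projection to these variables of every finite part of `q`. By compactness `φ` can be added to `q`,
against maximality. -/
theorem isMaxTuple_of_maximal {q : Set (L.Formula α)}
    (hq : Maximal (fun q => (∀ φ ∈ q, IsPositive φ) ∧ Consistent T q) q)
    {A : Type u} [L.Structure A] [A ⊨ T] [Nonempty A] {v : α → A}
    (hv : ∀ φ ∈ q, φ.Realize v) : IsMaxTuple T v := by
  classical
  intro k j φ hφ hn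
  by_contra! hcon
  have key : Consistent T (insert (φ.relabel j) q) := by
    refine consistent_of_finite fun s hs => ?_
    obtain ⟨χ, hχ, hχs⟩ := exists_conj (s.filter (· ∈ q)) fun ψ hψ =>
      hq.prop.1 ψ (Finset.mem_filter.1 hψ).2
    obtain ⟨E, hE, hE'⟩ := exists_project j χ hχ
    have hEv : E.Realize (v ∘ j) :=
      (hE' A _).2 ⟨v, rfl, (hχs A v).2 fun ψ hψ => hv ψ (Finset.mem_filter.1 hψ).2⟩
    have := hcon E hE hEv
    simp only [Contradictory, not_forall, not_not] at this
    obtain ⟨B, w, hw, hw'⟩ := this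
    obtain ⟨u, rfl, hu⟩ := (hE' B w).1 hw'
    refine ⟨B, u, fun ψ hψ => ?_⟩
    rcases hs hψ with rfl | h
    · simpa using hw
    · exact (hχs B u).1 hu ψ (Finset.mem_filter.2 ⟨hψ, h⟩)
  have hmem : φ.relabel j ∈ q := by
    refine hq.le_of_ge ⟨?_, key⟩ (Set.subset_insert _ _) (Set.mem_insert _ _)
    rintro ψ (rfl | h)
    · exact hφ.relabel j
    · exact hq.prop.1 ψ h
  exact hn (by simpa using hv _ hmem)

/-- Every tuple of a pec model is maximal. -/
theorem IsPec.isMaxTuple {N : Type u} [L.Structure N] [Nonempty N] (hN : IsPec T N)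
    {β : Type*} (v : β → N) : IsMaxTuple T v := by
  have := hN.1
  refine IsMaxTuple.comp (v := (id : N → N)) ?_ v
  -- The positive diagram of a pec model is maximal: a model of a larger set is a continuation of
  -- `N`, hence an immersion, and so satisfies no new positive formula about `N`.
  refine isMaxTuple_of_maximal (q := {φ : L.Formula N | IsPositive φ ∧ φ.Realize id}) ?_
    fun φ hφ => hφ.2
  refine ⟨⟨fun φ hφ => hφ.1, Theory.ModelType.of T N, id, fun φ hφ => hφ.2⟩, ?_⟩
  rintro q' ⟨hpos, B, w, hw⟩ hle φ hφ
  obtain ⟨f, rfl⟩ := exists_hom_of_preserves w fun φ hφ h => hw φ (hle ⟨hφ, h⟩)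
  refine ⟨hpos φ hφ, ?_⟩
  obtain ⟨k, j, ρ, hρ, h⟩ := exists_fin_support' φ (hpos φ hφ)
  exact (h N id).2 ((hN.2 B f k ρ hρ _).1 ((h B f).1 (hw φ hφ)))

/-- Immersions preserve and reflect positive formulas in arbitrary tuples of variables. -/
theorem IsImmersion.realize_iff {A B : Type u} [L.Structure A] [L.Structure B] {f : A →[L] B}
    (hf : IsImmersion f) {β : Type*} {φ : L.Formula β} (hφ : IsPositive φ) (v : β → A) :
    φ.Realize (f ∘ v) ↔ φ.Realize v := by
  obtain ⟨k, j, ρ, hρ, h⟩ := exists_fin_support' φ hφ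
  rw [h, h]
  exact hf k ρ hρ _

variable {N : Type u} [L.Structure N] {n : ℕ}

/-- A maximal type is the positive type of a maximal tuple. -/
theorem exists_realization {q : Set (L.Formula (N ⊕ Fin n))} (hq : q ∈ MaximalTypes T N n) :
    ∃ (A : Theory.ModelType.{u, u, u} T) (f : N →[L] A) (c : Fin n → A),
      IsMaxTuple T (Sum.elim f c) ∧
      ∀ φ : L.Formula (N ⊕ Fin n), φ ∈ q ↔ IsPositive φ ∧ φ.Realize (Sum.elim f c) := by
  obtain ⟨⟨hpos, A, f, c, hc⟩, hmax⟩ := hq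
  have hmem : ∀ φ : L.Formula (N ⊕ Fin n), φ ∈ q ↔ IsPositive φ ∧ φ.Realize (Sum.elim f c) := by
    refine fun φ => ⟨fun h => ⟨hpos φ h, hc φ h⟩, fun h => ?_⟩
    exact hmax (y := {φ | IsPositive φ ∧ φ.Realize (Sum.elim f c)})
      ⟨fun φ h => h.1, A, f, c, fun φ h => h.2⟩ (fun φ h => ⟨hpos φ h, hc φ h⟩) h
  refine ⟨A, f, c, ?_, hmem⟩
  refine isMaxTuple_of_maximal (q := q) ⟨⟨hpos, A, _, hc⟩, ?_⟩ hc
  rintro q' ⟨hpos', B, w, hw⟩ hle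
  refine hmax ⟨hpos', B, ?_⟩ hle
  -- Since `q` contains the positive diagram of `N`, any model of a larger set is automatically a
  -- continuation of `N`, and maximality among types over `N` applies.
  obtain ⟨g, hg⟩ := exists_hom_of_preserves (w ∘ Sum.inl) fun φ hφ (h : φ.Realize (id : N → N)) => by
    have := hw (φ.relabel Sum.inl) (hle ((hmem _).2 ⟨hφ.relabel _, ?_⟩))
    · simpa using this
    · simpa using hφ.realize_formula_hom f h
  refine ⟨g, w ∘ Sum.inr, fun φ hφ => ?_⟩
  rw [hg, Sum.elim_comp_inl_inr]
  exact hw φ hφ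

/-- The positive type of a maximal tuple is a maximal type. -/
theorem IsMaxTuple.mem_maximalTypes {A : Type u} [L.Structure A] [A ⊨ T] [Nonempty A]
    (f : N →[L] A) (c : Fin n → A) (h : IsMaxTuple T (Sum.elim f c)) :
    {φ : L.Formula (N ⊕ Fin n) | IsPositive φ ∧ φ.Realize (Sum.elim f c)} ∈
      MaximalTypes T N n := by
  refine ⟨⟨fun φ h => h.1, Theory.ModelType.of T A, f, c, fun φ h => h.2⟩, ?_⟩
  rintro q' ⟨hpos, B, g, b, hb⟩ hle φ hφ
  refine ⟨hpos φ hφ, ?_⟩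
  exact (h.realize_iff (fun φ hφ h => hb φ (hle ⟨hφ, h⟩)) (hpos φ hφ)).2 (hb φ hφ)

theorem MaximalTypes.entails_iff {q : Set (L.Formula (N ⊕ Fin n))} (hq : q ∈ MaximalTypes T N n)
    {φ : L.Formula (N ⊕ Fin n)} (hφ : IsPositive φ) : Entails T q φ ↔ φ ∈ q := by
  obtain ⟨A, f, c, hmax, hmem⟩ := exists_realization hq
  refine ⟨fun h => (hmem φ).2 ⟨hφ, h A f c fun ψ hψ => ((hmem ψ).1 hψ).2⟩,
    fun h B g b hb => hb φ h⟩

/-- Any realisation of `q` has the same positive type over `N` as the maximal tuple realising it.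
This turns non-membership into the kind of entailment that negative coheirs respond to. -/
theorem MaximalTypes.entails_not {q : Set (L.Formula (N ⊕ Fin n))} (hq : q ∈ MaximalTypes T N n)
    {φ : L.Formula (N ⊕ Fin n)} (hφ : IsPositive φ) (hn : φ ∉ q) : Entails T q φ.not := by
  obtain ⟨A, f, c, hmax, hmem⟩ := exists_realization hq
  intro B g b hb
  rw [Formula.realize_not]
  intro h
  exact hn ((hmem φ).2 ⟨hφ, (hmax.realize_iff (fun ψ hψ h => hb ψ ((hmem ψ).2 ⟨hψ, h⟩)) hφ).2 h⟩)

/-- Every partial type extends to a maximal type. -/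
theorem IsPartialType.exists_maximal {p : Set (L.Formula (N ⊕ Fin n))}
    (hp : IsPartialType T N p) : ∃ q ∈ MaximalTypes T N n, p ⊆ q := by
  suffices key : ∀ C ⊆ {q | IsPartialType T N q}, IsChain (· ⊆ ·) C → C.Nonempty →
      ∃ ub ∈ {q | IsPartialType T N q}, ∀ s ∈ C, s ⊆ ub by
    obtain ⟨q, hpq, hq⟩ := zorn_subset_nonempty {q | IsPartialType T N q} key p hp
    exact ⟨q, hq, hpq⟩
  intro C hC hchain hne
  refine ⟨⋃₀ C, ⟨?_, ?_⟩, fun s hs => Set.subset_sUnion_of_mem hs⟩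
  · rintro φ ⟨s, hs, hφ⟩
    exact (hC hs).1 φ hφ
  -- The positive diagram of `N` is added so that the model obtained by compactness is a
  -- continuation of `N`.
  let D : Set (L.Formula (N ⊕ Fin n)) :=
    {ψ | ∃ φ : L.Formula N, IsPositive φ ∧ φ.Realize id ∧ ψ = φ.relabel Sum.inl}
  have hcons : Consistent T (D ∪ ⋃₀ C) := by
    refine consistent_of_finite fun s hs => ?_
    have hfin : ((s : Set _) ∩ ⋃₀ C).Finite := s.finite_toSet.inter_of_left _
    obtain ⟨r, hr, hsr⟩ := hchain.directedOn.exists_mem_subset_of_finset_subset_biUnion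
      (f := id) hne (s := hfin.toFinset) (by
        intro φ hφ
        have : φ ∈ (s : Set _) ∩ ⋃₀ C := by simpa using hφ
        simpa using this.2)
    obtain ⟨-, A, f, a, ha⟩ := hC hr
    refine ⟨A, Sum.elim f a, fun φ hφ => ?_⟩
    rcases hs hφ with ⟨ψ, hψ, hψN, rfl⟩ | h
    · simpa using hψ.realize_formula_hom f hψN
    · exact ha φ (hsr (by simpa using ⟨hφ, h⟩))
  obtain ⟨A, v, hv⟩ := hcons
  obtain ⟨f, hf⟩ := exists_hom_of_preserves (v ∘ Sum.inl) fun φ hφ (h : φ.Realize (id : N → N)) => by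
    simpa using hv _ (Or.inl ⟨φ, hφ, h, rfl⟩)
  refine ⟨A, f, v ∘ Sum.inr, fun φ hφ => ?_⟩
  rw [hf, Sum.elim_comp_inl_inr]
  exact hv φ (Or.inr hφ)

end Maximality

/-! ### Infinitary combinatorics -/

section Combinatorics

/-- Dependent choices along a well-order. -/
theorem exists_wellFounded_choice {ι X : Type*} [LinearOrder ι] [WellFoundedLT ι] [Nonempty X]
    (P : (i : ι) → (Set.Iio i → X) → X → Prop)
    (h : ∀ (i : ι) (g : ι → X), (∀ j < i, P j (fun k => g k) (g j)) →
      ∃ x, P i (fun k => g k) x) :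
    ∃ g : ι → X, ∀ i, P i (fun k => g k) (g i) := by
  classical
  let G : (i : ι) → ((j : ι) → j < i → X) → X := fun i r =>
    if hx : ∃ x, P i (fun k => r k k.2) x then hx.choose else Classical.arbitrary X
  let g : ι → X := (wellFounded_lt (α := ι)).fix G
  have hg (i : ι) : g i = G i fun j _ => g j := WellFounded.fix_eq _ _ _
  refine ⟨g, fun i => ?_⟩
  induction i using WellFoundedLT.induction with
  | ind i ih =>
    have hx := h i g ih
    rw [hg i]
    simp only [G, dif_pos hx]
    exact hx.choose_spec

/-- In a well-order with small initial segments, small sets are strictly bounded. -/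
theorem exists_strict_bound {ι : Type u} [LinearOrder ι] {τ : Cardinal.{u}} (hτ : ℵ₀ ≤ τ)
    (hseg : ∀ i : ι, #(Set.Iio i) ≤ τ) (hι : τ < #ι) (Z : Set ι) (hZ : #Z ≤ τ) :
    ∃ i, ∀ z ∈ Z, z < i := by
  by_contra! hcon
  -- If `Z` were unbounded, at most `τ` initial segments of size at most `τ` would cover `ι`.
  have hcov : (Set.univ : Set ι) ⊆ ⋃ z ∈ Z, Set.Iic z := fun i _ => by
    obtain ⟨z, hz, hiz⟩ := hcon i
    exact Set.mem_biUnion hz hiz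
  refine hι.not_ge ?_
  calc #ι = #(Set.univ : Set ι) := mk_univ.symm
    _ ≤ #(⋃ z ∈ Z, Set.Iic z : Set ι) := mk_le_mk_of_subset hcov
    _ ≤ #Z * ⨆ z : Z, #(Set.Iic z.1) := mk_biUnion_le _ _
    _ ≤ τ * τ := by
      refine mul_le_mul' hZ (ciSup_le' fun z => ?_)
      rw [← Set.Iio_insert]
      exact (mk_insert_le).trans (add_le_of_le hτ (hseg _) (one_le_aleph0.trans hτ))
    _ = τ := mul_eq_self hτ

/-- Closing off under `2 ^ τ` operations of arity `τ` does not exceed cardinality `2 ^ τ`. -/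
theorem exists_closed_set {X O τ : Type u} [Infinite τ] (hO : #O ≤ 2 ^ #τ)
    (op : O → (τ → X) → X) (X₀ : Set X) (h₀ : #X₀ ≤ 2 ^ #τ) :
    ∃ Y : Set X, X₀ ⊆ Y ∧ #Y ≤ 2 ^ #τ ∧ ∀ o z, (∀ i, z i ∈ Y) → op o z ∈ Y := by
  have hτ : ℵ₀ ≤ #τ := aleph0_le_mk τ
  have h2 : ℵ₀ ≤ (2 : Cardinal.{u}) ^ #τ := hτ.trans (cantor _).le
  -- Successor-of-`τ` many stages suffice: the arguments of an operation, being at most `τ` in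
  -- number, all appear before a common stage.
  let ι := (Order.succ #τ).ord.ToType
  have hι : #ι = Order.succ #τ := mk_ord_toType _
  have hseg (i : ι) : #(Set.Iio i) ≤ #τ := by
    simpa [ι] using mk_Iio_lt i (by simp [ι])
  let G : (i : ι) → ((j : ι) → j < i → Set X) → Set X := fun i r =>
    X₀ ∪ Set.range fun p : O × (τ → (⋃ j : Set.Iio i, r j j.2 : Set X)) =>
      op p.1 fun t => p.2 t
  let Y : ι → Set X := (wellFounded_lt (α := ι)).fix G
  have hY (i : ι) : Y i = G i fun j _ => Y j := WellFounded.fix_eq _ _ _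
  have hcard (i : ι) : #(Y i) ≤ 2 ^ #τ := by
    induction i using WellFoundedLT.induction with
    | ind i ih =>
      have hU : #(⋃ j : Set.Iio i, Y j : Set X) ≤ 2 ^ #τ :=
        calc _ ≤ #(Set.Iio i) * ⨆ j : Set.Iio i, #(Y j) := mk_iUnion_le _
          _ ≤ 2 ^ #τ * 2 ^ #τ :=
            mul_le_mul' ((hseg i).trans (cantor _).le) (ciSup_le' fun j => ih j j.2)
          _ = 2 ^ #τ := mul_eq_self h2
      rw [hY i]
      refine (mk_union_le _ _).trans (add_le_of_le h2 h₀ (mk_range_le.trans ?_))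
      rw [mk_prod, lift_id, lift_id, ← power_def]
      calc _ ≤ 2 ^ #τ * (2 ^ #τ) ^ #τ := mul_le_mul' hO (power_le_power_right hU)
        _ = 2 ^ #τ := by rw [← power_mul, mul_eq_self hτ, mul_eq_self h2]
  have hne : Nonempty ι := mk_ne_zero_iff.1 (by rw [hι]; exact (Order.succ_ne_bot _))
  refine ⟨⋃ i, Y i, fun x hx => ?_, ?_, fun o z hz => ?_⟩
  · obtain ⟨i⟩ := hne
    refine Set.mem_iUnion.2 ⟨i, ?_⟩
    rw [hY i]
    exact Or.inl hx
  · calc _ ≤ #ι * ⨆ i, #(Y i) := mk_iUnion_le _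
      _ ≤ 2 ^ #τ * 2 ^ #τ := mul_le_mul' (hι.trans_le (Order.succ_le_of_lt (cantor _)))
        (ciSup_le' hcard)
      _ = 2 ^ #τ := mul_eq_self h2
  · choose s hs using fun i => Set.mem_iUnion.1 (hz i)
    obtain ⟨i, hi⟩ := exists_strict_bound hτ hseg (by rw [hι]; exact Order.lt_succ _)
      (Set.range s) mk_range_le
    refine Set.mem_iUnion.2 ⟨i, ?_⟩
    rw [hY i]
    exact Or.inr ⟨⟨o, fun t => ⟨z t, Set.mem_iUnion.2 ⟨⟨s t, hi _ ⟨t, rfl⟩⟩, hs t⟩⟩⟩, rfl⟩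

/-- A set of cardinality above `2 ^ τ` has a subset of cardinality above `τ` which is
end-homogeneous for a given colouring. -/
theorem exists_end_homogeneous {I K : Type u} [LinearOrder I] [WellFoundedLT I] {τ : Cardinal.{u}}
    (hτ : ℵ₀ ≤ τ) (hK : #K ≤ τ) (S : Set I) (hS : 2 ^ τ < #S) {s : ℕ}
    (F : (Fin (s + 1) → I) → K) :
    ∃ J ⊆ S, τ < #J ∧ ∃ F' : (Fin s → I) → K, ∀ (t : Fin s → I) (j : I), (∀ i, t i ∈ J) → j ∈ J →
      (∀ i, t i < j) → F (Fin.snoc t j) = F' t := by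
  classical
  have h2 : ℵ₀ ≤ (2 : Cardinal.{u}) ^ τ := hτ.trans (cantor _).le
  -- Cut `S` at the first point with more than `2 ^ τ` predecessors in `S`, if there is one.
  obtain ⟨S₁, hS₁, hS₁card, hseg⟩ : ∃ S₁ ⊆ S, 2 ^ τ < #S₁ ∧ ∀ i : S₁, #(Set.Iio i) ≤ 2 ^ τ := by
    have hio (S' : Set I) (i : S') : #(Set.Iio i) = #(S' ∩ Set.Iio i.1 : Set I) := by
      rw [← mk_image_eq Subtype.val_injective]
      congr 2
      ext x
      simp only [Set.mem_image, Set.mem_Iio, Subtype.exists, Set.mem_inter_iff]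
      constructor
      · rintro ⟨y, hy, hlt, rfl⟩; exact ⟨hy, hlt⟩
      · rintro ⟨hx, hlt⟩; exact ⟨x, hx, hlt, rfl⟩
    by_cases hb : ∃ i : S, 2 ^ τ < #(S ∩ Set.Iio i.1 : Set I)
    · let i := (wellFounded_lt (α := S)).min {i | 2 ^ τ < #(S ∩ Set.Iio i.1 : Set I)} hb
      have hi : 2 ^ τ < #(S ∩ Set.Iio i.1 : Set I) := WellFounded.min_mem _ _ hb
      refine ⟨S ∩ Set.Iio i.1, Set.inter_subset_left, hi, fun j => ?_⟩
      have hj : ¬ 2 ^ τ < #(S ∩ Set.Iio j.1 : Set I) := fun h =>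
        WellFounded.not_lt_min wellFounded_lt {i : S | 2 ^ τ < #(S ∩ Set.Iio i.1 : Set I)}
          (x := ⟨j.1, j.2.1⟩) h j.2.2
      rw [hio]
      refine (mk_le_mk_of_subset ?_).trans (not_lt.1 hj)
      exact Set.inter_subset_inter_left _ Set.inter_subset_left
    · push Not at hb
      exact ⟨S, subset_rfl, hS, fun i => (hio S i).trans_le (hb i)⟩
  let τ' : Type u := τ.out
  have hτ' : #τ' = τ := mk_out τ
  have : Infinite τ' := by rw [infinite_iff, hτ']; exact hτ
  have hne : Nonempty S₁ := mk_ne_zero_iff.1 (ne_bot_of_gt hS₁card)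
  let O := ((Fin s → τ') → K) × Set τ'
  have hO : #O ≤ 2 ^ #τ' := by
    rw [mk_prod, lift_id, lift_id, ← power_def, mk_set, hτ']
    refine mul_le_of_le h2 ?_ le_rfl
    calc _ ≤ τ ^ (τ ^ s) := by
          simpa [mk_arrow, hτ'] using power_le_power_right hK
      _ ≤ τ ^ τ := power_le_power_left (aleph0_pos.trans_le hτ).ne' (power_nat_le hτ)
      _ = 2 ^ τ := power_self_eq hτ
  -- The pattern of `x` over a family `z` records the colours of all tuples from `z` followed by
  -- `x`, and which members of `z` lie below `x`. There are at most `2 ^ τ` patterns; `op` chooses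
  -- an element with a given pattern.
  let pat : (τ' → S₁) → S₁ → O := fun z x =>
    (fun j => F (Fin.snoc (fun i => (z (j i) : I)) x), {i | z i < x})
  let op : O → (τ' → S₁) → S₁ := fun o z =>
    if h : ∃ x, pat z x = o then h.choose else Classical.arbitrary S₁
  obtain ⟨Y, hY₀, hYcard, hYop⟩ := exists_closed_set hO op {Classical.arbitrary S₁}
    (by rw [mk_singleton]; exact one_le_aleph0.trans (h2.trans_eq (by rw [hτ'])))
  rw [hτ'] at hYcard
  -- A point above the closed set `Y` serves as a guide: the `y i` are chosen in `Y`, increasing,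
  -- each with the pattern of `x` over its predecessors. The colour of a tuple followed by a later
  -- `y j` is then its colour followed by `x`, independent of `j`.
  obtain ⟨x, hx⟩ := exists_strict_bound h2 hseg hS₁card Y hYcard
  let ι := (Order.succ τ).ord.ToType
  have hι : #ι = Order.succ τ := mk_ord_toType _
  have hιseg (i : ι) : #(Set.Iio i) ≤ τ := by
    simpa [ι] using mk_Iio_lt i (by simp [ι])
  obtain ⟨y, hy⟩ := exists_wellFounded_choice (ι := ι) (X := S₁)
    (fun i g b => b ∈ Y ∧ (∀ j, g j < b) ∧ ∀ t : Fin s → Set.Iio i,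
      F (Fin.snoc (fun k => (g (t k) : I)) b) = F (Fin.snoc (fun k => (g (t k) : I)) x)) (by
    intro i g hg
    obtain ⟨e⟩ : Nonempty (Set.Iio i ↪ τ') := by
      rw [← Cardinal.le_def, hτ']; exact hιseg i
    let z : τ' → S₁ := Function.extend e (fun k => g k) fun _ => Classical.arbitrary S₁
    have hze (k : Set.Iio i) : z (e k) = g k := e.injective.extend_apply _ _ _
    have hzY (k : τ') : z k ∈ Y := by
      by_cases hk : ∃ a, e a = k
      · obtain ⟨a, rfl⟩ := hk
        rw [hze]
        exact (hg a a.2).1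
      · simp only [z, Function.extend_apply' _ _ _ hk]
        exact hY₀ rfl
    have hex : ∃ b, pat z b = pat z x := ⟨x, rfl⟩
    have hb := hex.choose_spec
    refine ⟨hex.choose, ?_, fun j => ?_, fun t => ?_⟩
    · have := hYop (pat z x) z hzY
      simpa only [op, dif_pos hex] using this
    · have := Set.ext_iff.1 (congrArg Prod.snd hb) (e j)
      simp only [pat, Set.mem_ofPred_eq, hze] at this
      exact this.2 (hx _ (hg j j.2).1)
    · have := congrFun (congrArg Prod.fst hb) fun k => e (t k)
      simpa only [pat, hze] using this)
  have hmono : StrictMono fun i => (y i : I) := fun i j hij => (hy j).2.1 ⟨i, hij⟩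
  refine ⟨Set.range fun i => (y i : I), ?_, ?_, fun t => F (Fin.snoc t x), ?_⟩
  · rintro _ ⟨i, rfl⟩
    exact hS₁ (y i).2
  · rw [mk_range_eq _ hmono.injective, hι]
    exact Order.lt_succ _
  · rintro t _ ht ⟨j, rfl⟩ hlt
    choose a ha using ht
    have haj (k : Fin s) : a k < j := hmono.lt_iff_lt.1 ((ha k).trans_lt (hlt k))
    have := (hy j).2.2 fun k => ⟨a k, haj k⟩
    simpa only [ha] using this

/-- Iterated exponentials of a cardinal. -/
noncomputable def iterExp (ν : Cardinal.{u}) : ℕ → Cardinal.{u}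
  | 0 => ν
  | r + 1 => 2 ^ iterExp ν r

theorem le_iterExp (ν : Cardinal.{u}) (r : ℕ) : ν ≤ iterExp ν r := by
  induction r with
  | zero => exact le_rfl
  | succ r ih => exact ih.trans (cantor _).le

theorem iterExp_beth (α : Ordinal.{u}) (r : ℕ) : iterExp (beth α) r = beth (α + r) := by
  induction r with
  | zero => simp [iterExp]
  | succ r ih => rw [iterExp, ih, Nat.cast_succ, ← add_assoc, beth_add_one]

/-- The Erdős–Rado theorem. -/
theorem erdos_rado {I K : Type u} [LinearOrder I] [WellFoundedLT I] {ν : Cardinal.{u}}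
    (hν : ℵ₀ ≤ ν) (hK : #K ≤ ν) (r : ℕ) (S : Set I) (hS : iterExp ν r < #S)
    (F : (Fin (r + 1) → I) → K) :
    ∃ H ⊆ S, ν < #H ∧ ∃ k, ∀ t : Fin (r + 1) → I, StrictMono t → (∀ i, t i ∈ H) → F t = k := by
  induction r generalizing S with
  | zero =>
    -- The pigeonhole principle applies because the successor of `ν` is regular and there are at
    -- most `ν` colours.
    obtain ⟨k, hk⟩ := infinite_pigeonhole_card (fun x : S => F fun _ => x) (Order.succ ν)
      (Order.succ_le_of_lt hS) (hν.trans (Order.le_succ _))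
      (by rw [(isRegular_succ hν).cof_ord]; exact Order.lt_succ_of_le hK)
    refine ⟨Subtype.val '' ((fun x : S => F fun _ => x) ⁻¹' {k}), by simp, ?_, k, ?_⟩
    · rw [mk_image_eq Subtype.val_injective]
      exact Order.succ_le_iff.1 hk
    · intro t _ ht
      obtain ⟨x, hx, hxt⟩ := ht 0
      rw [← Set.mem_singleton_iff.1 hx]
      congr 1
      ext i
      obtain rfl : i = 0 := Subsingleton.elim (α := Fin 1) i 0
      exact hxt.symm
  | succ r ih =>
    have hτ : ν ≤ iterExp ν r := le_iterExp ν r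
    -- On an end-homogeneous set the colour ignores the last entry, which lowers the arity by one at
    -- the cost of one exponential.
    obtain ⟨J, hJ, hJcard, F', hF'⟩ :=
      exists_end_homogeneous (hν.trans hτ) (hK.trans hτ) S hS F
    obtain ⟨H, hH, hHcard, k, hk⟩ := ih J hJcard F'
    refine ⟨H, hH.trans hJ, hHcard, k, fun t ht htH => ?_⟩
    have := hF' (fun i => t i.castSucc) (t (Fin.last _)) (fun i => hH (htH _)) (hH (htH _))
      fun i => ht (Fin.castSucc_lt_last i)
    rw [show (Fin.snoc (fun i => t i.castSucc) (t (Fin.last _)) : Fin (r + 1 + 1) → I) = t from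
      Fin.snoc_init_self t] at this
    rw [this]
    exact hk _ (fun i j hij => ht (Fin.castSucc_lt_castSucc_iff.2 hij)) fun i => htH _

/-- An injective sequence has a subsequence that is increasing or nowhere increasing; the second
kind would descend, against well-foundedness. -/
theorem exists_strictMono_of_infinite {I : Type*} [LinearOrder I] [WellFoundedLT I] {H : Set I}
    (hH : H.Infinite) : ∃ h : ℕ → I, StrictMono h ∧ ∀ n, h n ∈ H := by
  have := hH.to_subtype
  let f := Infinite.natEmbedding H
  obtain ⟨g, hg | hg⟩ := exists_increasing_or_nonincreasing_subseq (α := I) (· < ·) fun n => f n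
  · exact ⟨fun n => f (g n), fun m n h => hg m n h, fun n => (f (g n)).2⟩
  · exfalso
    obtain ⟨_, ⟨n, rfl⟩, hmin⟩ := (wellFounded_lt (α := I)).has_min
      (Set.range fun n => (f (g n) : I)) ⟨_, 0, rfl⟩
    have h1 := hg n (n + 1) n.lt_succ_self
    have h2 := hmin _ ⟨n + 1, rfl⟩
    have h3 : (f (g n) : I) = f (g (n + 1)) := le_antisymm (not_lt.1 h2) (not_lt.1 h1)
    have := g.injective (f.injective (Subtype.ext h3))
    omega

/-- On a well-order of cardinality at least the Hanf-type bound `ℶ_(μ⁺)`, any countable family of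
colourings with at most `μ` colours admits a coherent sequence of colours. -/
theorem exists_coherent_colours {μ : Cardinal.{u}} (hμ : ℵ₀ ≤ μ) {I : Type u} [LinearOrder I]
    [WellFoundedLT I] (hI : beth (Order.succ μ).ord ≤ #I) (K : ℕ → Type u)
    (hK : ∀ r, #(K r) ≤ μ) (F : ∀ r, (Fin (r + 1) → I) → K r) :
    ∃ p : ∀ r, K r, ∀ n, ∃ h : ℕ → I, StrictMono h ∧ ∀ r < n, ∀ t : Fin (r + 1) → ℕ,
      StrictMono t → F r (h ∘ t) = p r := by
  classical
  let δ := (Order.succ μ).ord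
  have hμδ : μ.ord < δ := ord_lt_ord.2 (Order.lt_succ _)
  have hlim : Order.IsSuccLimit δ := isSuccLimit_ord (hμ.trans (Order.le_succ _))
  -- A single set cannot be refined infinitely often without losing size, so one refines a family
  -- containing sets of size `beth α` for all `α < δ`.
  let Large : Set (Set I) → Prop := fun C =>
    (∀ H ∈ C, ∀ H' ⊆ H, H' ∈ C) ∧ ∀ α < δ, ∃ H ∈ C, beth α ≤ #H
  let Hom : (r : ℕ) → K r → Set (Set I) := fun r k =>
    {H | ∀ t : Fin (r + 1) → I, StrictMono t → (∀ i, t i ∈ H) → F r t = k}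
  have step (r : ℕ) (C : Set (Set I)) (hC : Large C) : ∃ k : K r, Large (C ∩ Hom r k) := by
    by_contra! hcon
    have hclosed (k : K r) : ∀ H ∈ C ∩ Hom r k, ∀ H' ⊆ H, H' ∈ C ∩ Hom r k :=
      fun H hH H' hH' => ⟨hC.1 H hH.1 H' hH', fun t ht htH => hH.2 t ht fun i => hH' (htH i)⟩
    have hbd (k : K r) : ∃ α < δ, ∀ H ∈ C ∩ Hom r k, #H < beth α := by
      have := hcon k
      simp only [Large, not_and, not_forall, not_exists] at this
      obtain ⟨α, hα, h⟩ := this (hclosed k)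
      exact ⟨α, hα, fun H hH => not_le.1 (h H hH)⟩
    choose a haδ ha using hbd
    have hsup : ⨆ k, a k < δ := Ordinal.iSup_lt_of_lt_cof
      (by rw [(isRegular_succ hμ).cof_ord]; exact Order.lt_succ_of_le (hK r)) haδ
    -- If no colour worked, the bounds for the at most `μ` colours would have a supremum below the
    -- regular `δ`. A set of size `beth (α + r + 1)` then has a homogeneous subset larger than every
    -- bound. Including `μ.ord` makes `beth α` at least the number of colours.
    let α := max μ.ord (⨆ k, a k)
    have hα : α < δ := max_lt hμδ hsup
    have hαr (m : ℕ) : α + m < δ := by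
      induction m with
      | zero => simpa using hα
      | succ m ih => rw [Nat.cast_succ, ← add_assoc]; exact hlim.add_one_lt ih
    obtain ⟨H, hH, hHcard⟩ := hC.2 _ (hαr (r + 1))
    have hHlt : iterExp (beth α) r < #H := by
      rw [iterExp_beth]
      refine lt_of_lt_of_le (beth_lt_beth.2 ?_) hHcard
      rw [Nat.cast_succ, ← add_assoc]
      exact lt_add_one _
    obtain ⟨H', hH', hcard', k, hk⟩ := erdos_rado (aleph0_le_beth α)
      ((hK r).trans ((le_beth_ord μ).trans (beth_le_beth.2 (le_max_left _ _)))) r H hHlt (F r)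
    refine (ha k H' ⟨hC.1 H hH H' hH', hk⟩).not_ge (le_trans (beth_le_beth.2 ?_) hcard'.le)
    exact (Ordinal.le_iSup a k).trans (le_max_right _ _)
  have h0 : Large Set.univ :=
    ⟨fun _ _ _ _ => trivial, fun α hα => ⟨Set.univ, trivial, by
      rw [mk_univ]; exact (beth_le_beth.2 hα.le).trans hI⟩⟩
  let C : ℕ → {C // Large C} := fun n => Nat.rec ⟨Set.univ, h0⟩
    (fun r C => ⟨_, (step r C.1 C.2).choose_spec⟩) n
  refine ⟨fun r => (step r (C r).1 (C r).2).choose, fun n => ?_⟩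
  have hsub (n : ℕ) : ∀ r < n, (C n).1 ⊆ Hom r (step r (C r).1 (C r).2).choose := by
    induction n with
    | zero => intro r hr; omega
    | succ n ih =>
      intro r hr
      rcases Nat.lt_succ_iff_lt_or_eq.1 hr with h | rfl
      · exact Set.inter_subset_left.trans (ih r h)
      · exact Set.inter_subset_right
  obtain ⟨H, hH, hHcard⟩ := (C n).2.2 0 (lt_of_le_of_lt zero_le hμδ)
  rw [beth_zero, aleph0_le_mk_iff] at hHcard
  obtain ⟨h, hmono, hmem⟩ := exists_strictMono_of_infinite (Set.infinite_coe_iff.1 hHcard)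
  exact ⟨h, hmono, fun r hr t ht => hsub n r hr hH _ (hmono.comp ht) fun i => hmem _⟩

/-- On an infinite set there are ultrafilters indexed by the sets of subsets, any two of which are
separated by a set from a fixed independent family. -/
theorem exists_independent_ultrafilters (J : Type u) [Infinite J] :
    ∃ (W : Set J → Set J) (D : Set (Set J) → Ultrafilter J),
      ∀ Z X, (X ∈ Z → W X ∈ D Z) ∧ (X ∉ Z → (W X)ᶜ ∈ D Z) := by
  classical
  obtain ⟨e⟩ : Nonempty (J ≃ Finset J × Finset (Finset J)) := by
    rw [← Cardinal.eq, mk_prod, lift_id, lift_id, mk_finset_of_infinite, mk_finset_of_infinite,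
      mk_finset_of_infinite, mul_eq_self (aleph0_le_mk J)]
  -- Hausdorff's independent family: an index codes a finite set together with finitely many finite
  -- sets, and lies in `W X` when the trace of `X` on the former is one of the latter.
  let W : Set J → Set J := fun X => {j | (e j).1.filter (· ∈ X) ∈ (e j).2}
  let B : Set (Set J) → Set J → Set J := fun Z X => if X ∈ Z then W X else (W X)ᶜ
  have hfip (Z : Set (Set J)) : ∃ D : Ultrafilter J, Set.range (B Z) ⊆ D.sets := by
    refine Ultrafilter.exists_ultrafilter_of_finite_inter_nonempty _ fun S hS => ?_
    rw [← Set.image_univ, Finset.subset_set_image_iff] at hS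
    obtain ⟨S, -, rfl⟩ := hS
    have hsep (X Y : Set J) : ∃ j, X ≠ Y → ¬ (j ∈ X ↔ j ∈ Y) := by
      by_cases h : X = Y
      · exact ⟨Classical.arbitrary J, fun h' => (h' h).elim⟩
      · by_contra! hcon
        exact h (Set.ext fun j => (hcon j).2)
    choose d hd using hsep
    -- A finite set on which distinct members of `S` have distinct traces.
    let A : Finset J := (S ×ˢ S).image fun p => d p.1 p.2
    refine ⟨e.symm (A, (S.filter (· ∈ Z)).image fun X => A.filter (· ∈ X)), ?_⟩
    simp only [Finset.coe_image, Set.sInter_image, Set.mem_iInter]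
    intro Y hY
    simp only [B]
    split_ifs with hYZ
    · simp only [W, Set.mem_ofPred_eq, Equiv.apply_symm_apply]
      exact Finset.mem_image_of_mem _ (Finset.mem_filter.2 ⟨hY, hYZ⟩)
    · simp only [W, Set.mem_compl_iff, Set.mem_ofPred_eq, Equiv.apply_symm_apply, Finset.mem_image,
        Finset.mem_filter, not_exists, not_and, and_imp]
      intro X hX hXZ hXY
      have hne : X ≠ Y := fun h => hYZ (h ▸ hXZ)
      refine hd X Y hne ?_
      have hmem : d X Y ∈ A := Finset.mem_image_of_mem (fun p : Set J × Set J => d p.1 p.2)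
        (Finset.mk_mem_product hX hY)
      have := Finset.ext_iff.1 hXY (d X Y)
      simpa [hmem] using this
  choose D hD using hfip
  refine ⟨W, D, fun Z X => ⟨fun h => ?_, fun h => ?_⟩⟩
  · simpa [B, h] using hD Z ⟨X, rfl⟩
  · simpa [B, h] using hD Z ⟨X, rfl⟩

end Combinatorics

/-! ### Saturation -/

section Saturation

variable {L : FirstOrder.Language.{u, u}} {T : L.Theory} {κ : Cardinal.{u}}
  {U : Type u} [L.Structure U]

/-- Saturation in terms of families of parameters. -/
theorem IsSaturated.satisfiable (hs : IsSaturated L κ U) {β : Type u} (hβ : #β < κ) (b : β → U)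
    {n : ℕ} (S : Set (L.Formula (β ⊕ Fin n))) (hpos : ∀ φ ∈ S, IsPositive φ)
    (hfin : ∀ S₀ : Finset (L.Formula (β ⊕ Fin n)), (S₀ : Set (L.Formula (β ⊕ Fin n))) ⊆ S →
      ∃ x : Fin n → U, ∀ φ ∈ S₀, φ.Realize (Sum.elim b x)) :
    ∃ x : Fin n → U, ∀ φ ∈ S, φ.Realize (Sum.elim b x) := by
  classical
  let r : β ⊕ Fin n → Set.range b ⊕ Fin n := Sum.map (Set.rangeFactorization b) id
  have hr (x : Fin n → U) : Sum.elim (fun a : Set.range b => (a : U)) x ∘ r = Sum.elim b x := by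
    ext (i | i) <;> rfl
  obtain ⟨x, hx⟩ := hs (Set.range b) (mk_range_le.trans_lt hβ) n ((fun φ => φ.relabel r) '' S)
    (by rintro _ ⟨φ, hφ, rfl⟩; exact (hpos φ hφ).relabel r) (fun S₀ hS₀ => by
      obtain ⟨S₁, hS₁, rfl⟩ := Finset.subset_set_image_iff.1 hS₀
      obtain ⟨x, hx⟩ := hfin S₁ hS₁
      refine ⟨x, fun φ hφ => ?_⟩
      obtain ⟨ψ, hψ, rfl⟩ := Finset.mem_image.1 hφ
      rw [Formula.realize_relabel, hr]
      exact hx ψ hψ)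
  refine ⟨x, fun φ hφ => ?_⟩
  have := hx _ ⟨φ, hφ, rfl⟩
  rwa [Formula.realize_relabel, hr] at this

/-- Positive types of finite tuples over small families of parameters are realised. -/
theorem IsSaturated.exists_realize (hs : IsSaturated L κ U) {A : Type u} [L.Structure A]
    {β : Type u} (hβ : #β < κ) (b : β → U) (b' : β → A) {n : ℕ} (c : Fin n → A)
    (h : ∀ φ : L.Formula β, IsPositive φ → φ.Realize b' → φ.Realize b) :
    ∃ x : Fin n → U, ∀ φ : L.Formula (β ⊕ Fin n), IsPositive φ →
      φ.Realize (Sum.elim b' c) → φ.Realize (Sum.elim b x) := by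
  obtain ⟨x, hx⟩ := hs.satisfiable hβ b
    {φ : L.Formula (β ⊕ Fin n) | IsPositive φ ∧ φ.Realize (Sum.elim b' c)} (fun φ hφ => hφ.1)
    (fun S₀ hS₀ => by
      obtain ⟨χ, hχ, hχS⟩ := exists_conj S₀ fun φ hφ => (hS₀ hφ).1
      have := h _ (hχ.iExs (β := Fin n))
        (Formula.realize_iExs.2 ⟨c, (hχS A _).2 fun φ hφ => (hS₀ hφ).2⟩)
      obtain ⟨x, hx⟩ := Formula.realize_iExs.1 this
      exact ⟨x, (hχS U _).1 hx⟩)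
  exact ⟨x, fun φ hφ h => hx φ ⟨hφ, h⟩⟩

/-- Small tuples of an extension can be copied into a saturated structure. -/
theorem IsSaturated.exists_copy (hs : IsSaturated L κ U) [Nonempty U] (hκ : ℵ₀ ≤ κ) {A : Type u}
    [L.Structure A] (f : U →[L] A) (hf : IsImmersion f) {β γ : Type u} (hβ : #β < κ) (hγ : #γ < κ)
    (b : β → U) (c : γ → A) :
    ∃ c' : γ → U, ∀ φ : L.Formula (β ⊕ γ), IsPositive φ →
      φ.Realize (Sum.elim (f ∘ b) c) → φ.Realize (Sum.elim b c') := by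
  classical
  obtain ⟨_, _⟩ := exists_wellFoundedLT γ
  -- The elements of `c` are copied one at a time along a well-order. A formula has only finitely
  -- many variables, so it is controlled at the largest index it mentions.
  let P : (i : γ) → (Set.Iio i → U) → U → Prop := fun i g x =>
    ∀ φ : L.Formula ((β ⊕ Set.Iio i) ⊕ Fin 1), IsPositive φ →
      φ.Realize (Sum.elim (Sum.elim (f ∘ b) fun k => c k) fun _ => c i) →
      φ.Realize (Sum.elim (Sum.elim b g) fun _ => x)
  have key (g : γ → U) (k : ℕ) (j : Fin k → γ) (hj : ∀ i, P (j i) (fun l => g l) (g (j i)))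
      (ρ : L.Formula (β ⊕ Fin k)) (hρ : IsPositive ρ)
      (h : ρ.Realize (Sum.elim (f ∘ b) (c ∘ j))) : ρ.Realize (Sum.elim b (g ∘ j)) := by
    -- With no variable from `γ` there is no largest index, and reflection by `f` is used instead.
    rcases isEmpty_or_nonempty (Fin k) with hk | hk
    · rw [← hf.realize_iff hρ]
      convert h using 1
      ext (i | i)
      · rfl
      · exact hk.elim i
    · obtain ⟨m, hm⟩ := Finite.exists_max j
      let r : β ⊕ Fin k → (β ⊕ Set.Iio (j m)) ⊕ Fin 1 := Sum.elim (fun i => Sum.inl (Sum.inl i))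
        fun i => if h : j i < j m then Sum.inl (Sum.inr ⟨j i, h⟩) else Sum.inr 0
      have hr {X : Type u} (b₀ : β → X) (c₀ : γ → X) :
          Sum.elim (Sum.elim b₀ fun l : Set.Iio (j m) => c₀ l) (fun _ : Fin 1 => c₀ (j m)) ∘ r =
            Sum.elim b₀ (c₀ ∘ j) := by
        ext (i | i)
        · rfl
        · by_cases hi : j i < j m
          · simp [r, hi]
          · simp [r, (hm i).antisymm (not_lt.1 hi)]
      have := hj m (ρ.relabel r) (hρ.relabel r)
      rw [Formula.realize_relabel, Formula.realize_relabel, hr, hr] at this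
      exact this h
  obtain ⟨c', hc'⟩ := exists_wellFounded_choice P (fun i g hg => by
    have hlt : #(β ⊕ Set.Iio i) < κ := by
      rw [mk_sum, lift_id, lift_id]
      exact add_lt_of_lt hκ hβ ((mk_subtype_le _).trans_lt hγ)
    obtain ⟨x, hx⟩ := hs.exists_realize hlt (Sum.elim b fun l => g l)
      (Sum.elim (f ∘ b) fun l : Set.Iio i => c l) (fun _ : Fin 1 => c i) (fun φ hφ h => by
        obtain ⟨k, j, ρ, hρ, hρφ⟩ := exists_fin_support φ hφ
        exact (hρφ U _ _).2 (key g k (fun i => j i) (fun i => hg _ (j i).2) ρ hρ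
          ((hρφ A _ _).1 h)))
    refine ⟨x 0, fun φ hφ h => ?_⟩
    convert hx φ hφ h using 3 with i
    rw [Subsingleton.elim i 0])
  refine ⟨c', fun φ hφ h => ?_⟩
  obtain ⟨k, j, ρ, hρ, hρφ⟩ := exists_fin_support φ hφ
  exact (hρφ U _ _).2 (key c' k j (fun i => hc' _) ρ hρ ((hρφ A _ _).1 h))

theorem IsPec.isImmersion {A : Type u} [L.Structure A] [A ⊨ T] [Nonempty A] (hU : IsPec T U)
    (f : U →[L] A) : IsImmersion f :=
  hU.2 (Theory.ModelType.of T A) f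

variable [Nonempty U]

/-- Saturation for small tuples of variables. -/
theorem IsSaturated.satisfiable_small (hs : IsSaturated L κ U) (hU : IsPec T U) (hκ : ℵ₀ ≤ κ)
    {β γ : Type u} (hβ : #β < κ) (hγ : #γ < κ) (b : β → U) (S : Set (L.Formula (β ⊕ γ)))
    (hpos : ∀ φ ∈ S, IsPositive φ)
    (hfin : ∀ S₀ : Finset (L.Formula (β ⊕ γ)), (S₀ : Set (L.Formula (β ⊕ γ))) ⊆ S →
      ∃ x : γ → U, ∀ φ ∈ S₀, φ.Realize (Sum.elim b x)) :
    ∃ x : γ → U, ∀ φ ∈ S, φ.Realize (Sum.elim b x) := by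
  classical
  have := hU.1
  -- Adding the positive diagram of `U` yields a solution in a continuation of `U`, which is then
  -- copied back.
  let D : Set (L.Formula (U ⊕ γ)) :=
    {ψ | ∃ φ : L.Formula U, IsPositive φ ∧ φ.Realize id ∧ ψ = φ.relabel Sum.inl}
  let r : β ⊕ γ → U ⊕ γ := Sum.map b id
  have hcons : Consistent T (D ∪ (fun φ => φ.relabel r) '' S) := by
    refine consistent_of_finite fun s hs => ?_
    have hsub : ((s.filter (· ∈ (fun φ => φ.relabel r) '' S) : Finset (L.Formula (U ⊕ γ))) :
        Set (L.Formula (U ⊕ γ))) ⊆ (fun φ => φ.relabel r) '' S :=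
      fun φ hφ => (Finset.mem_filter.1 hφ).2
    obtain ⟨S₀, hS₀, hS₀s⟩ := Finset.subset_set_image_iff.1 hsub
    obtain ⟨x, hx⟩ := hfin S₀ hS₀
    refine ⟨Theory.ModelType.of T U, Sum.elim id x, fun φ hφ => ?_⟩
    by_cases h : φ ∈ (fun φ => φ.relabel r) '' S
    · have hmem : φ ∈ S₀.image (fun φ => φ.relabel r) := hS₀s ▸ Finset.mem_filter.2 ⟨hφ, h⟩
      obtain ⟨ψ, hψ, rfl⟩ := Finset.mem_image.1 hmem
      have hr : (Sum.elim id x : U ⊕ γ → U) ∘ r = Sum.elim b x := by ext (i | i) <;> rfl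
      exact Formula.realize_relabel.2 (hr ▸ hx ψ hψ)
    · rcases hs hφ with ⟨ψ, hψ, hψU, rfl⟩ | h'
      · rw [Formula.realize_relabel]
        exact hψU
      · exact (h h').elim
  obtain ⟨A, v, hv⟩ := hcons
  obtain ⟨f, hf⟩ := exists_hom_of_preserves (v ∘ Sum.inl)
    fun φ hφ (h : φ.Realize (id : U → U)) => by simpa using hv _ (Or.inl ⟨φ, hφ, h, rfl⟩)
  obtain ⟨x, hx⟩ := hs.exists_copy hκ f (hU.isImmersion f) hβ hγ b (v ∘ Sum.inr)
  refine ⟨x, fun φ hφ => hx φ (hpos φ hφ) ?_⟩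
  have := hv _ (Or.inr ⟨φ, hφ, rfl⟩)
  rw [Formula.realize_relabel] at this
  convert this using 1
  ext (i | i)
  · simp [r, hf]
  · rfl

/-- The restriction of a maximal tuple to a small family of parameters is realised exactly. -/
theorem IsSaturated.exists_realize_iff (hs : IsSaturated L κ U) (hU : IsPec T U) {A : Type u}
    [L.Structure A] [A ⊨ T] [Nonempty A] (f : U →[L] A) {n : ℕ} {c : Fin n → A}
    (hc : IsMaxTuple T (Sum.elim f c)) {β : Type u} (hβ : #β < κ) (b : β → U) :
    ∃ x : Fin n → U, ∀ φ : L.Formula (β ⊕ Fin n), IsPositive φ →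
      (φ.Realize (Sum.elim (f ∘ b) c) ↔ φ.Realize (Sum.elim b x)) := by
  have := hU.1
  obtain ⟨x, hx⟩ := hs.exists_realize hβ b (f ∘ b) c fun φ hφ h =>
    ((hU.isImmersion f).realize_iff hφ b).1 h
  refine ⟨x, fun φ hφ => IsMaxTuple.realize_iff (T := T) ?_ hx hφ⟩
  convert hc.comp (Sum.map b id) using 1
  ext (i | i) <;> rfl

end Saturation

/-! ### Cardinalities of sets of formulas -/

section Counting

variable {L : FirstOrder.Language.{u, u}}

theorem card_formula_le (α : Type u) : #(L.Formula α) ≤ max ℵ₀ (#α + L.card) := by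
  refine le_trans (mk_le_of_injective (f := fun φ : L.Formula α =>
    (⟨0, φ⟩ : Σ n, L.BoundedFormula α n)) fun φ ψ h => by simpa using h) ?_
  simpa using BoundedFormula.card_le (L := L) (α := α)

theorem aleph0_le_theoryCard (T : L.Theory) : ℵ₀ ≤ theoryCard T :=
  le_max_left _ _

theorem theoryCard_lt_lambdaT (T : L.Theory) : (2 : Cardinal.{u}) ^ theoryCard T < lambdaT T :=
  calc (2 : Cardinal.{u}) ^ theoryCard T < Order.succ (2 ^ theoryCard T) := Order.lt_succ _
    _ ≤ lambdaT T := le_beth_ord _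

theorem aleph0_le_lambdaT (T : L.Theory) : ℵ₀ ≤ lambdaT T :=
  aleph0_le_beth _

theorem card_formula_le_add (T : L.Theory) (β : Type u) (α : Type u) (hα : #α ≤ ℵ₀) :
    #(L.Formula (β ⊕ α)) ≤ #β + theoryCard T := by
  have hT := aleph0_le_theoryCard T
  refine (card_formula_le _).trans (max_le (hT.trans (self_le_add_left _ _)) ?_)
  rw [mk_sum, lift_id, lift_id, add_assoc]
  gcongr
  exact add_le_of_le hT (hα.trans hT) (le_max_right _ _)

end Counting

section PlugFamily

variable {L : FirstOrder.Language.{u, u}} {U : Type u} {n : ℕ}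

/-- The formula `φ(x; b)` for a family `b` of parameters. -/
def plugFamily {β : Type*} (φ : L.Formula (Fin n ⊕ β)) (b : β → U) : L.Formula (U ⊕ Fin n) :=
  φ.relabel (Sum.elim Sum.inr fun i => Sum.inl (b i))

theorem realize_plugFamily {β : Type*} {A : Type*} [L.Structure A] (φ : L.Formula (Fin n ⊕ β))
    (b : β → U) (f : U → A) (c : Fin n → A) :
    (plugFamily φ b).Realize (Sum.elim f c) ↔ φ.Realize (Sum.elim c (f ∘ b)) := by
  rw [plugFamily, Formula.realize_relabel]
  refine iff_of_eq (congrArg _ ?_)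
  ext (i | i) <;> rfl

end PlugFamily

/-! ### Morley sequences -/

section Morley

variable {L : FirstOrder.Language.{u, u}} {T : L.Theory} {κ : Cardinal.{u}}
  {U : Type u} [L.Structure U] {n : ℕ}

/-- Two families of elements have the same positive type over `M`. -/
def SameTypeOver (M : L.Substructure U) {β : Type*} (b b' : β → U) : Prop :=
  ∀ φ : L.Formula (M ⊕ β), IsPositive φ →
    (φ.Realize (Sum.elim (fun m : M => (m : U)) b) ↔
      φ.Realize (Sum.elim (fun m : M => (m : U)) b'))

theorem SameTypeOver.comp {M : L.Substructure U} {β γ : Type*} {b b' : β → U}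
    (h : SameTypeOver M b b') (g : γ → β) : SameTypeOver M (b ∘ g) (b' ∘ g) := fun φ hφ => by
  have := h (φ.relabel (Sum.map id g)) (hφ.relabel _)
  rw [Formula.realize_relabel, Formula.realize_relabel] at this
  convert this using 2 <;> · ext (i | i) <;> rfl

/-- Adding the elements of `M` to families with the same type over `M`. -/
theorem SameTypeOver.elim {M : L.Substructure U} {β : Type*} {b b' : β → U}
    (h : SameTypeOver M b b') :
    SameTypeOver M (Sum.elim (fun m : M => (m : U)) b) (Sum.elim (fun m : M => (m : U)) b') := by
  intro φ hφ
  have := h (φ.relabel (Sum.elim Sum.inl id)) (hφ.relabel _)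
  rw [Formula.realize_relabel, Formula.realize_relabel] at this
  convert this using 2 <;> · ext (i | i | i) <;> rfl

/-- Invariance for formulas with arbitrary families of parameters. -/
theorem IsInvariant.mem_iff {M : L.Substructure U} {q : Set (L.Formula (U ⊕ Fin n))}
    (hq : q ∈ MaximalTypes T U n) (hinv : IsInvariant T M q) {β : Type*} {b b' : β → U}
    (h : SameTypeOver M b b') (φ : L.Formula (Fin n ⊕ β)) (hφ : IsPositive φ) :
    plugFamily φ b ∈ q ↔ plugFamily φ b' ∈ q := by
  obtain ⟨k, j, ρ, hρ, hρφ⟩ := exists_fin_support φ hφ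
  have key := hinv k (b ∘ j) (b' ∘ j) (h.comp j) ρ hρ
  rw [MaximalTypes.entails_iff hq (φ := plug ρ (b ∘ j)) (hρ.relabel _),
    MaximalTypes.entails_iff hq (φ := plug ρ (b' ∘ j)) (hρ.relabel _)] at key
  obtain ⟨A, f, c, -, hmem⟩ := exists_realization hq
  have hpl (d : β → U) : plugFamily φ d ∈ q ↔ plug ρ (d ∘ j) ∈ q := by
    rw [hmem, hmem, realize_plugFamily, hρφ,
      show plug ρ (d ∘ j) = plugFamily ρ (d ∘ j) from rfl, realize_plugFamily]
    exact and_congr ⟨fun _ => hρ.relabel _, fun _ => hφ.relabel _⟩ Iff.rfl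
  rw [hpl, hpl, key]

/-- The tuple `x` has over `B` exactly the positive type prescribed by `q`. -/
def RealizesOver (q : Set (L.Formula (U ⊕ Fin n))) (B : Set U) (x : Fin n → U) : Prop :=
  ∀ (φ : L.Formula (Fin n ⊕ B)), IsPositive φ →
    (plugFamily φ (fun b : B => (b : U)) ∈ q ↔ φ.Realize (Sum.elim x fun b : B => (b : U)))

theorem RealizesOver.mem_iff {q : Set (L.Formula (U ⊕ Fin n))} {B : Set U} {x : Fin n → U}
    (hx : RealizesOver q B x) (hq : q ∈ MaximalTypes T U n) {β : Type*} {b : β → U}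
    (hb : ∀ i, b i ∈ B) (φ : L.Formula (Fin n ⊕ β)) (hφ : IsPositive φ) :
    plugFamily φ b ∈ q ↔ φ.Realize (Sum.elim x b) := by
  let r : Fin n ⊕ β → Fin n ⊕ B := Sum.map id fun i => ⟨b i, hb i⟩
  have key := hx (φ.relabel r) (hφ.relabel r)
  obtain ⟨A, f, c, -, hmem⟩ := exists_realization hq
  rw [hmem, realize_plugFamily, Formula.realize_relabel, Formula.realize_relabel] at key
  rw [hmem, realize_plugFamily]
  have h1 : Sum.elim x (fun b : B => (b : U)) ∘ r = Sum.elim x b := by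
    ext (i | i) <;> rfl
  have h2 : Sum.elim c (f ∘ fun b : B => (b : U)) ∘ r = Sum.elim c (f ∘ b) := by
    ext (i | i) <;> rfl
  rw [h1, h2] at key
  rw [← key]
  exact and_congr ⟨fun _ => (hφ.relabel r).relabel _, fun _ => hφ.relabel _⟩ Iff.rfl

theorem IsMonster.exists_realizesOver [Nonempty U] (hU : IsMonster T κ U)
    {q : Set (L.Formula (U ⊕ Fin n))} (hq : q ∈ MaximalTypes T U n) (B : Set U) (hB : #B < κ) :
    ∃ x, RealizesOver q B x := by
  obtain ⟨A, f, c, hmax, hmem⟩ := exists_realization hq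
  obtain ⟨x, hx⟩ := hU.saturated.exists_realize_iff hU.pec f hmax hB fun b : B => (b : U)
  refine ⟨x, fun φ hφ => ?_⟩
  rw [hmem, realize_plugFamily]
  have := hx (φ.relabel Sum.swap) (hφ.relabel _)
  rw [Formula.realize_relabel, Formula.realize_relabel, Sum.elim_swap, Sum.elim_swap] at this
  exact ⟨fun h => this.1 h.2, fun h => ⟨hφ.relabel _, this.2 h⟩⟩

/-- Sequences of realisations of prescribed global types over the previous elements. -/
theorem IsMonster.exists_morley [Nonempty U] (hU : IsMonster T κ U) (hκ : ℵ₀ ≤ κ)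
    (s : ℕ → Set (L.Formula (U ⊕ Fin n))) (hs : ∀ i, s i ∈ MaximalTypes T U n) (B : Set U)
    (hB : #B < κ) :
    ∃ a : ℕ → Fin n → U,
      ∀ i, RealizesOver (s i) (B ∪ ⋃ j : Set.Iio i, Set.range (a j)) (a i) := by
  refine exists_wellFounded_choice (X := Fin n → U)
    (fun i g x => RealizesOver (s i) (B ∪ ⋃ j : Set.Iio i, Set.range (g j)) x)
    fun i g _ => hU.exists_realizesOver (hs i) _ ?_
  refine (mk_union_le _ _).trans_lt (add_lt_of_lt hκ hB (lt_of_lt_of_le ?_ hκ))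
  exact (Set.finite_iUnion fun j => Set.finite_range _).lt_aleph0

/-- Invariant types whose Morley sequences have the same type over `M` can be alternated freely. -/
theorem sameTypeOver_of_morley {M : L.Substructure U} {B : Set U} (hMB : (M : Set U) ⊆ B)
    {s : ℕ → Set (L.Formula (U ⊕ Fin n))} (hs : ∀ i, s i ∈ MaximalTypes T U n)
    (hinv : ∀ i, IsInvariant T M (s i)) {c : ℕ → Fin n → U}
    (hc : ∀ i, RealizesOver (s i) (B ∪ ⋃ j : Set.Iio i, Set.range (c j)) (c i))
    {a : ℕ → Fin n → U}
    (ha : ∀ i, ∃ a' : ℕ → Fin n → U,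
      (∀ k, RealizesOver (s i) (M ∪ ⋃ j : Set.Iio k, Set.range (a' j)) (a' k)) ∧
      SameTypeOver M (fun v : ℕ × Fin n => a' v.1 v.2) fun v : ℕ × Fin n => a v.1 v.2)
    (k : ℕ) (i : Fin k → ℕ) (hi : StrictMono i) :
    SameTypeOver M (fun v : Fin k × Fin n => c (i v.1) v.2)
      fun v : Fin k × Fin n => a v.1 v.2 := by
  induction k with
  | zero =>
    intro φ _
    refine iff_of_eq (congrArg _ ?_)
    ext (m | v)
    · rfl
    · exact v.1.elim0
  | succ k ih =>
    intro φ hφ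
    let e : M ⊕ (Fin (k + 1) × Fin n) → Fin n ⊕ (M ⊕ (Fin k × Fin n)) := Sum.elim
      (fun m => Sum.inr (Sum.inl m))
      fun v => Fin.lastCases (motive := fun _ => Fin n ⊕ (M ⊕ (Fin k × Fin n))) (Sum.inl v.2)
        (fun l => Sum.inr (Sum.inr (l, v.2))) v.1
    have he (d : Fin (k + 1) → Fin n → U) :
        φ.Realize (Sum.elim (fun m : M => (m : U)) fun v => d v.1 v.2) ↔
        (φ.relabel e).Realize (Sum.elim (d (Fin.last k)) (Sum.elim (fun m : M => (m : U))
          fun v => d v.1.castSucc v.2)) := by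
      rw [Formula.realize_relabel]
      refine iff_of_eq (congrArg _ ?_)
      ext (m | ⟨l, r⟩)
      · rfl
      · refine Fin.lastCases ?_ (fun l => ?_) l <;> simp [e]
    obtain ⟨a', ha', haa'⟩ := ha (i (Fin.last k))
    have ih' := ih (fun l => i l.castSucc)
      fun l l' h => hi (Fin.castSucc_lt_castSucc_iff.2 h)
    have hsame : SameTypeOver M (fun v : Fin k × Fin n => a' v.1 v.2)
        fun v : Fin k × Fin n => a v.1 v.2 :=
      haa'.comp fun v : Fin k × Fin n => ((v.1 : ℕ), v.2)
    have hφe := hφ.relabel e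
    have hq := hs (i (Fin.last k))
    have h1 := he fun l => c (i l)
    have h2 := (hc (i (Fin.last k))).mem_iff hq (b := Sum.elim (fun m : M => (m : U))
      fun v : Fin k × Fin n => c (i v.1.castSucc) v.2) (by
        rintro (m | v)
        · exact Or.inl (hMB m.2)
        · exact Or.inr (Set.mem_iUnion.2 ⟨⟨_, hi (Fin.castSucc_lt_last v.1)⟩, v.2, rfl⟩))
      _ hφe
    have h3 := (hinv (i (Fin.last k))).mem_iff hq ih'.elim _ hφe
    have h4 := (hinv (i (Fin.last k))).mem_iff hq hsame.elim _ hφe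
    have h5 := (ha' k).mem_iff hq (b := Sum.elim (fun m : M => (m : U))
      fun v : Fin k × Fin n => a' v.1 v.2) (by
        rintro (m | v)
        · exact Or.inl m.2
        · exact Or.inr (Set.mem_iUnion.2 ⟨⟨_, v.1.2⟩, v.2, rfl⟩))
      _ hφe
    have h6 := he fun l => a' l
    have h7 := haa'.comp (fun v : Fin (k + 1) × Fin n => ((v.1 : ℕ), v.2)) φ hφ
    -- The last tuple of `c` realises its type over the earlier ones, so truth becomes membership in
    -- that type. Invariance replaces the earlier tuples by those of `a` and then of `a'`, over
    -- which the next tuple of `a'` realises the same type.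
    rw [h1, ← h2, h3, ← h4, h5]
    exact h6.symm.trans h7

/-- In a saturated structure, a system of positive conditions on a tuple over a small family of
tuples has a solution as soon as its finite parts do. -/
theorem IsSaturated.exists_solution (hs : IsSaturated L κ U) (hκ : ℵ₀ ≤ κ) {J : Type u}
    (hJ : #J < κ) {k : ℕ} (a : J → Fin n → U) (θ : J → L.Formula (Fin n ⊕ Fin k))
    (hθ : ∀ j, IsPositive (θ j))
    (hfin : ∀ t : Finset J, ∃ y : Fin k → U, ∀ j ∈ t, (θ j).Realize (Sum.elim (a j) y)) :
    ∃ y : Fin k → U, ∀ j, (θ j).Realize (Sum.elim (a j) y) := by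
  classical
  have hr (j : J) (y : Fin k → U) :
      Sum.elim (fun v : J × Fin n => a v.1 v.2) y ∘
        (Sum.map (fun r => (j, r)) id : Fin n ⊕ Fin k → (J × Fin n) ⊕ Fin k) =
      Sum.elim (a j) y := by
    ext (i | i) <;> rfl
  obtain ⟨y, hy⟩ := hs.satisfiable (β := J × Fin n) (by
      rw [mk_prod, lift_id']
      simpa using mul_lt_of_lt hκ hJ (natCast_lt_aleph0.trans_le hκ))
    (fun v => a v.1 v.2)
    (Set.range fun j => (θ j).relabel (Sum.map (fun r => (j, r)) id))
    (by rintro _ ⟨j, rfl⟩; exact (hθ j).relabel _) (fun S₀ hS₀ => by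
      rw [← Set.image_univ] at hS₀
      obtain ⟨t, -, rfl⟩ := Finset.subset_set_image_iff.1 hS₀
      obtain ⟨y, hy⟩ := hfin t
      refine ⟨y, fun φ hφ => ?_⟩
      obtain ⟨j, hj, rfl⟩ := Finset.mem_image.1 hφ
      rw [Formula.realize_relabel, hr]
      exact hy j hj)
  refine ⟨y, fun j => ?_⟩
  have := hy _ ⟨j, rfl⟩
  rwa [Formula.realize_relabel, hr] at this

end Morley

/-! ### NIP bounds the number of invariant extensions -/

section NIP

variable {L : FirstOrder.Language.{u, u}} {T : L.Theory} {κ : Cardinal.{u}}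
  {U : Type u} [L.Structure U] {n : ℕ}

/-- Distinct global types are separated by contradictory formulas with the same parameters. -/
theorem MaximalTypes.exists_separation {N : Type u} [L.Structure N]
    {q₁ q₂ : Set (L.Formula (N ⊕ Fin n))} (h₁ : q₁ ∈ MaximalTypes T N n)
    (h₂ : q₂ ∈ MaximalTypes T N n) (hne : q₁ ≠ q₂) :
    ∃ (k : ℕ) (j : Fin k → N) (φ ψ : L.Formula (Fin n ⊕ Fin k)), IsPositive φ ∧ IsPositive ψ ∧
      Contradictory T φ ψ ∧ plugFamily φ j ∈ q₁ ∧ plugFamily ψ j ∈ q₂ := by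
  obtain ⟨φ, hφ₁, hφ₂⟩ := Set.not_subset.1 fun h : q₁ ⊆ q₂ => hne (h₁.eq_of_ge h₂.1 h).symm
  obtain ⟨A, f, c, -, hmem₁⟩ := exists_realization h₁
  obtain ⟨B, g, d, hmax, hmem₂⟩ := exists_realization h₂
  have hφ := h₁.1.1 φ hφ₁
  obtain ⟨k, j, ρ, hρ, hρφ⟩ := exists_fin_support (φ.relabel Sum.swap) (hφ.relabel _)
  simp only [Formula.realize_relabel, Sum.elim_swap] at hρφ
  have hn : ¬ ρ.Realize (Sum.elim d (g ∘ j)) := by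
    rw [← hρφ]
    exact fun h => hφ₂ ((hmem₂ φ).2 ⟨hφ, h⟩)
  have hmax' : IsMaxTuple T (Sum.elim d (g ∘ j)) := by
    convert hmax.comp (Sum.elim Sum.inr fun i => Sum.inl (j i)) using 1
    ext (i | i) <;> rfl
  obtain ⟨ψ, hψ, hψd, hcon⟩ := hmax'.separate hρ hn
  refine ⟨k, j, ρ, ψ, hρ, hψ, hcon, (hmem₁ _).2 ⟨hρ.relabel _, ?_⟩, (hmem₂ _).2 ⟨hψ.relabel _, ?_⟩⟩
  · rw [realize_plugFamily, ← hρφ]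
    exact ((hmem₁ φ).1 hφ₁).2
  · rwa [realize_plugFamily]

variable [Nonempty U]

/-- Otherwise a sequence realising the two types alternately over the parameters `j` of a separating
pair has the same type over `M` as the pure Morley sequences. The pair then shatters every initial
segment of `a true`, and by saturation the whole sequence. -/
theorem IsNIP.eq_of_sameTypeOver (hT : IsNIP T) (hU : IsMonster T κ U) (hκ : ℵ₀ < κ)
    {M : L.Substructure U} (hM : #M < κ) {q : Bool → Set (L.Formula (U ⊕ Fin n))}
    (hq : ∀ i, q i ∈ MaximalTypes T U n) (hinv : ∀ i, IsInvariant T M (q i))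
    {a : Bool → ℕ → Fin n → U}
    (ha : ∀ i k, RealizesOver (q i) (M ∪ ⋃ j : Set.Iio k, Set.range (a i j)) (a i k))
    (hsame : SameTypeOver M (fun v : ℕ × Fin n => a false v.1 v.2)
      fun v : ℕ × Fin n => a true v.1 v.2) : q false = q true := by
  classical
  have := hU.pec.1
  by_contra hne
  obtain ⟨k, j, φ, ψ, hφ, hψ, hcon, hφq, hψq⟩ := MaximalTypes.exists_separation (hq _) (hq _) hne
  let s : ℕ → Set (L.Formula (U ⊕ Fin n)) := fun i => if Even i then q false else q true
  have hs (i : ℕ) : s i ∈ MaximalTypes T U n := by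
    simp only [s]; split_ifs <;> exact hq _
  have hsinv (i : ℕ) : IsInvariant T M (s i) := by
    simp only [s]; split_ifs <;> exact hinv _
  have hB : #((M : Set U) ∪ Set.range j : Set U) < κ :=
    (mk_union_le _ _).trans_lt
      (add_lt_of_lt hκ.le hM ((Set.finite_range j).lt_aleph0.trans hκ))
  obtain ⟨c, hc⟩ := hU.exists_morley hκ.le s hs _ hB
  have key := sameTypeOver_of_morley (a := a true) Set.subset_union_left hs hsinv hc (fun i => by
    by_cases h : Even i
    · exact ⟨a false, by simpa only [s, if_pos h] using ha false, hsame⟩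
    · exact ⟨a true, by simpa only [s, if_neg h] using ha true, fun _ _ => Iff.rfl⟩)
  have hjB (i : ℕ) (l : Fin k) :
      j l ∈ ((M : Set U) ∪ Set.range j) ∪ ⋃ j : Set.Iio i, Set.range (c j) :=
    Or.inl (Or.inr ⟨l, rfl⟩)
  have hcφ (i : ℕ) (hi : Even i) : φ.Realize (Sum.elim (c i) j) :=
    ((hc i).mem_iff (hs i) (hjB i) φ hφ).1 (by simpa only [s, if_pos hi] using hφq)
  have hcψ (i : ℕ) (hi : ¬ Even i) : ψ.Realize (Sum.elim (c i) j) :=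
    ((hc i).mem_iff (hs i) (hjB i) ψ hψ).1 (by simpa only [s, if_neg hi] using hψq)
  have hpat (W : Set ℕ) : ∃ y : Fin k → U, ∀ i : ULift.{u} ℕ,
      (if i.down ∈ W then φ else ψ).Realize (Sum.elim (a true i.down) y) := by
    refine hU.saturated.exists_solution hκ.le (by simpa using hκ) _ _
      (fun i => by split_ifs <;> assumption) fun t => ?_
    let N := t.sup ULift.down + 1
    let θ : Fin N → L.Formula ((Fin N × Fin n) ⊕ Fin k) := fun l =>
      (if (l : ℕ) ∈ W then φ else ψ).relabel (Sum.map (fun r => (l, r)) id)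
    obtain ⟨χ, hχ, hχθ⟩ := exists_conj (Finset.univ.image θ) (by
      simp only [Finset.mem_image, Finset.mem_univ, true_and, forall_exists_index,
        forall_apply_eq_imp_iff]
      intro l
      refine IsPositive.relabel ?_ _
      split_ifs <;> assumption)
    have hχ' (d : Fin N → Fin n → U) (y : Fin k → U) :
        χ.Realize (Sum.elim (fun v : Fin N × Fin n => d v.1 v.2) y) ↔
          ∀ l : Fin N, (if (l : ℕ) ∈ W then φ else ψ).Realize (Sum.elim (d l) y) := by
      simp only [hχθ, Finset.mem_image, Finset.mem_univ, true_and, forall_exists_index,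
        forall_apply_eq_imp_iff, θ, Formula.realize_relabel]
      refine forall_congr' fun l => iff_of_eq (congrArg _ ?_)
      ext (i | i) <;> rfl
    -- Choosing the even or the odd member of the `l`-th pair realises the pattern `W`, and the
    -- indices increase strictly whatever `W` is.
    let i : Fin N → ℕ := fun l => 2 * l + if (l : ℕ) ∈ W then 0 else 1
    have hi : StrictMono i := by
      intro l l' h
      have : (l : ℕ) < l' := h
      simp only [i]
      split_ifs <;> omega
    have hk := key N i hi ((χ.iExs (Fin k)).relabel Sum.inr) (hχ.iExs.relabel _)
    rw [Formula.realize_relabel, Formula.realize_relabel, Sum.elim_comp_inr, Sum.elim_comp_inr,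
      Formula.realize_iExs, Formula.realize_iExs] at hk
    obtain ⟨y, hy⟩ := hk.1 ⟨j, (hχ' (fun l => c (i l)) j).2 fun l => by
      split_ifs with h
      · exact hcφ _ (by simp [i, h])
      · exact hcψ _ (by simp [i, h])⟩
    refine ⟨y, fun l hl => ?_⟩
    exact (hχ' (fun l => a true l) y).1 hy ⟨l.down, Nat.lt_succ_of_le (Finset.le_sup hl)⟩
  choose b hb using hpat
  refine hT n k φ hφ ⟨ψ, hψ, fun A x y h => hcon A _ h.1 h.2, Theory.ModelType.of T U, a true, b,
    fun i W => ⟨fun h => ?_, fun h => ?_⟩⟩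
  · have := hb W ⟨i⟩
    rwa [if_pos h] at this
  · have := hb W ⟨i⟩
    rwa [if_neg h] at this

/-- Sending a type to the type over `M` of a chosen Morley sequence is injective, so it remains to
count sets of formulas over `M` in countably many variables. -/
theorem IsNIP.card_invariantExtensions_le (hT : IsNIP T) (hU : IsMonster T κ U) (hκ : ℵ₀ < κ)
    {M : L.Substructure U} (hM : #M < κ) (p : Set (L.Formula (M ⊕ Fin n))) :
    #(invariantExtensions T M p) ≤ 2 ^ (#M + theoryCard T) := by
  have hmor (q : invariantExtensions T M p) : ∃ a : ℕ → Fin n → U,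
      ∀ k, RealizesOver q.1 (M ∪ ⋃ j : Set.Iio k, Set.range (a j)) (a k) :=
    hU.exists_morley hκ.le (fun _ => q.1) (fun _ => q.2.1) M hM
  choose a ha using hmor
  let F : invariantExtensions T M p → Set (L.Formula (M ⊕ (ℕ × Fin n))) := fun q =>
    {φ | IsPositive φ ∧
      φ.Realize (Sum.elim (fun m : M => (m : U)) fun v : ℕ × Fin n => a q v.1 v.2)}
  have hF : Function.Injective F := by
    intro q₁ q₂ h
    refine Subtype.ext (hT.eq_of_sameTypeOver hU hκ hM (q := fun i => (bif i then q₂ else q₁).1)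
      (a := fun i => a (bif i then q₂ else q₁)) ?_ ?_ ?_ ?_)
    · rintro (_ | _)
      exacts [q₁.2.1, q₂.2.1]
    · rintro (_ | _)
      exacts [q₁.2.2.2, q₂.2.2.2]
    · rintro (_ | _)
      exacts [ha q₁, ha q₂]
    · intro φ hφ
      have := Set.ext_iff.1 h φ
      simpa [F, hφ] using this
  refine (mk_le_of_injective hF).trans ?_
  rw [mk_set]
  refine power_le_power_left two_ne_zero ?_
  refine le_trans ?_ (card_formula_le_add T M (ULift.{u} (ℕ × Fin n)) (by
    rw [mk_uLift, ← lift_aleph0.{u, 0}, lift_le]; exact mk_le_aleph0))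
  exact mk_le_of_injective (BoundedFormula.relabelEquiv
    (Equiv.sumCongr (Equiv.refl M) Equiv.ulift.symm)).injective

end NIP

/-! ### Indiscernible sequences and negative coheirs -/

section Coheir

variable {L : FirstOrder.Language.{u, u}} {T : L.Theory} {κ : Cardinal.{u}}
  {U : Type u} [L.Structure U]

theorem card_formula_le_theoryCard (T : L.Theory) (α : Type) [Countable α] :
    #(L.Formula α) ≤ theoryCard T := by
  refine le_trans (mk_le_of_injective (f := fun φ : L.Formula α =>
    (⟨0, φ⟩ : Σ n, L.BoundedFormula α n)) fun φ ψ h => by simpa using h) ?_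
  refine BoundedFormula.card_le.trans (max_le (le_max_left _ _) ?_)
  refine add_le_of_le (aleph0_le_theoryCard T) ?_ (by simp [theoryCard])
  exact le_trans (by simp) (aleph0_le_theoryCard T)

/-- Saturation for countable tuples of variables. -/
theorem IsSaturated.satisfiable_countable [Nonempty U] (hs : IsSaturated L κ U) (hU : IsPec T U)
    (hκ : ℵ₀ < κ) {β γ : Type} [Countable β] [Countable γ] (b : β → U)
    (S : Set (L.Formula (β ⊕ γ))) (hpos : ∀ φ ∈ S, IsPositive φ)
    (hfin : ∀ S₀ : Finset (L.Formula (β ⊕ γ)), (S₀ : Set (L.Formula (β ⊕ γ))) ⊆ S →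
      ∃ x : γ → U, ∀ φ ∈ S₀, φ.Realize (Sum.elim b x)) :
    ∃ x : γ → U, ∀ φ ∈ S, φ.Realize (Sum.elim b x) := by
  classical
  let r : β ⊕ γ → ULift.{u} β ⊕ ULift.{u} γ := Sum.map ULift.up ULift.up
  have hr (x : ULift.{u} γ → U) :
      Sum.elim (b ∘ ULift.down) x ∘ r = Sum.elim b (x ∘ ULift.up) := by
    ext (i | i) <;> rfl
  have hcard (δ : Type) [Countable δ] : #(ULift.{u} δ) < κ := by
    refine lt_of_le_of_lt ?_ hκ
    rw [mk_uLift, ← lift_aleph0.{u, 0}, lift_le]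
    exact mk_le_aleph0
  obtain ⟨x, hx⟩ := hs.satisfiable_small hU hκ.le (hcard β) (hcard γ) (b ∘ ULift.down)
    ((fun φ => φ.relabel r) '' S) (by rintro _ ⟨φ, hφ, rfl⟩; exact (hpos φ hφ).relabel r)
    (fun S₀ hS₀ => by
      obtain ⟨S₁, hS₁, rfl⟩ := Finset.subset_set_image_iff.1 hS₀
      obtain ⟨x, hx⟩ := hfin S₁ hS₁
      refine ⟨x ∘ ULift.down, fun φ hφ => ?_⟩
      obtain ⟨ψ, hψ, rfl⟩ := Finset.mem_image.1 hφ
      rw [Formula.realize_relabel, hr]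
      exact hx ψ hψ)
  refine ⟨x ∘ ULift.up, fun φ hφ => ?_⟩
  have := hx _ ⟨φ, hφ, rfl⟩
  rwa [Formula.realize_relabel, hr] at this

/-- Indiscernibility of a sequence of tuples indexed by an arbitrary type. -/
def IsIndiscernibleFamily (L : FirstOrder.Language.{u, u}) {U : Type u} [L.Structure U]
    {ι : Type} (a : ℕ → ι → U) : Prop :=
  ∀ (k : ℕ) (i j : Fin k → ℕ), StrictMono i → StrictMono j →
    ∀ φ : L.Formula (Fin k × ι), IsPositive φ →
      (φ.Realize (fun v => a (i v.1) v.2) ↔ φ.Realize (fun v => a (j v.1) v.2))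

theorem IsIndiscernibleFamily.realize_iff {ι : Type} {a : ℕ → ι → U}
    (h : IsIndiscernibleFamily L a) (φ : L.Formula ι) (hφ : IsPositive φ) (i j : ℕ) :
    φ.Realize (a i) ↔ φ.Realize (a j) := by
  have := h 1 (fun _ => i) (fun _ => j) (Subsingleton.strictMono _) (Subsingleton.strictMono _)
    (φ.relabel fun v => (0, v)) (hφ.relabel _)
  rw [Formula.realize_relabel, Formula.realize_relabel] at this
  exact this

/-- In thick theories indiscernibility is type-definable, for tuples indexed by any finite type. -/
theorem IsThick.exists_definition [Nonempty U] (hT : IsThick T) (hU : IsPec T U) (ι : Type)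
    [Finite ι] : ∃ Θ : Set (L.Formula (ℕ × ι)), (∀ φ ∈ Θ, IsPositive φ) ∧
      ∀ a : ℕ → ι → U,
        IsIndiscernibleFamily L a ↔ ∀ φ ∈ Θ, φ.Realize (fun v => a v.1 v.2) := by
  have := hU.1
  obtain ⟨n, ⟨e⟩⟩ := Finite.exists_equiv_fin ι
  obtain ⟨Θ, hΘ, h⟩ := hT n
  refine ⟨(fun φ => φ.relabel (Prod.map id e.symm)) '' Θ, ?_, fun a => ?_⟩
  · rintro _ ⟨φ, hφ, rfl⟩
    exact (hΘ φ hφ).relabel _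
  have key := h (Theory.ModelType.of T U) hU fun i v => a i (e.symm v)
  have h1 : (∀ φ ∈ (fun φ => φ.relabel (Prod.map id e.symm)) '' Θ,
      φ.Realize (fun v => a v.1 v.2)) ↔
      ∀ φ ∈ Θ, φ.Realize (fun v : ℕ × Fin n => a v.1 (e.symm v.2)) := by
    rw [Set.forall_mem_image]
    refine forall₂_congr fun φ _ => ?_
    rw [Formula.realize_relabel]
    rfl
  rw [h1]
  refine Iff.trans ?_ key
  refine forall₅_congr fun k i j hi hj => ⟨fun H φ hφ => ?_, fun H φ hφ => ?_⟩
  · have := H (φ.relabel (Prod.map id e.symm)) (hφ.relabel _)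
    rw [Formula.realize_relabel, Formula.realize_relabel] at this
    exact this
  · have this : (φ.relabel (Prod.map id e)).Realize (fun v => a (i v.1) (e.symm v.2)) ↔
        (φ.relabel (Prod.map id e)).Realize (fun v => a (j v.1) (e.symm v.2)) :=
      H (φ.relabel (Prod.map id e)) (hφ.relabel _)
    rw [Formula.realize_relabel, Formula.realize_relabel] at this
    convert this using 2 <;> · ext v; exact (congrArg _ (e.symm_apply_apply _)).symm

/-- Indiscernible sequences based on a long sequence of finite tuples. -/
theorem IsMonster.exists_indiscernible [Nonempty U] (hU : IsMonster T κ U) (hκ : ℵ₀ < κ)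
    {I : Type u} [LinearOrder I] [WellFoundedLT I] (hI : lambdaT T ≤ #I) {ι : Type} [Finite ι]
    (t : I → ι → U) :
    ∃ d : ℕ → ι → U, IsIndiscernibleFamily L d ∧ ∃ i j : I, i < j ∧
      ∀ φ : L.Formula (Fin 2 × ι), IsPositive φ →
        (φ.Realize (fun v => d v.1 v.2) ↔ φ.Realize fun v => t (![i, j] v.1) v.2) := by
  classical
  have := hU.pec.1
  have hμ : ℵ₀ ≤ (2 : Cardinal.{u}) ^ theoryCard T :=
    (aleph0_le_theoryCard T).trans (cantor _).le
  -- Increasing tuples are coloured by their positive types; there are at most `2 ^ |T|` colours,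
  -- which is where the index in the definition of `λ_T` comes from.
  let F : ∀ r, (Fin (r + 1) → I) → Set (L.Formula (Fin (r + 1) × ι)) := fun r s =>
    {φ | IsPositive φ ∧ φ.Realize fun v => t (s v.1) v.2}
  obtain ⟨p, hp⟩ := exists_coherent_colours hμ hI
    (fun r => Set (L.Formula (Fin (r + 1) × ι))) (fun r => by
      rw [mk_set]
      exact power_le_power_left two_ne_zero (card_formula_le_theoryCard T _)) F
  have hex (r : ℕ) : ∃ h : ℕ → I, StrictMono h ∧ F r (fun l => h l) = p r := by
    obtain ⟨h, hmono, hh⟩ := hp (r + 1)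
    exact ⟨h, hmono, hh r r.lt_succ_self (fun l => l) fun _ _ h => h⟩
  have hpos (r : ℕ) (φ) (hφ : φ ∈ p r) : IsPositive φ := by
    obtain ⟨h, -, hh⟩ := hex r
    rw [← hh] at hφ
    exact hφ.1
  let S : Set (L.Formula (Empty ⊕ (ℕ × ι))) := {ψ | ∃ (r : ℕ) (s : Fin (r + 1) → ℕ)
    (φ : L.Formula (Fin (r + 1) × ι)), StrictMono s ∧ φ ∈ p r ∧
      ψ = φ.relabel fun v => Sum.inr (s v.1, v.2)}
  obtain ⟨x, hx⟩ := hU.saturated.satisfiable_countable hU.pec hκ (Empty.elim : Empty → U) S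
    (by rintro _ ⟨r, s, φ, -, hφ, rfl⟩; exact (hpos r φ hφ).relabel _) (fun S₀ hS₀ => by
      have hS₀' : ∀ ψ ∈ S₀, ψ ∈ S := fun ψ hψ => hS₀ hψ
      choose! r hr using hS₀'
      obtain ⟨h, -, hh⟩ := hp (S₀.sup r + 1)
      refine ⟨fun v => t (h v.1) v.2, fun ψ hψ => ?_⟩
      obtain ⟨s, φ, hs, hφ, hψφ⟩ := hr ψ hψ
      rw [hψφ, Formula.realize_relabel]
      rw [← hh (r ψ) (Nat.lt_succ_of_le (Finset.le_sup hψ)) s hs] at hφ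
      exact hφ.2)
  -- Compactness only makes the prescribed types hold; positive types of tuples in a pec model are
  -- maximal, so they hold exactly.
  have key (r : ℕ) (s : Fin (r + 1) → ℕ) (hs : StrictMono s) (φ : L.Formula (Fin (r + 1) × ι))
      (hφ : IsPositive φ) : φ.Realize (fun v => x (s v.1, v.2)) ↔ φ ∈ p r := by
    have hreal (ψ) (hψ : ψ ∈ p r) : ψ.Realize fun v : Fin (r + 1) × ι => x (s v.1, v.2) := by
      have := hx _ ⟨r, s, ψ, hs, hψ, rfl⟩
      rw [Formula.realize_relabel] at this
      exact this
    refine ⟨fun h => ?_, hreal φ⟩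
    obtain ⟨h', -, hh⟩ := hex r
    rw [← hh] at hreal ⊢
    exact ⟨hφ, ((hU.pec.isMaxTuple fun v : Fin (r + 1) × ι => t (h' v.1) v.2).realize_iff
      (fun ψ hψ hψt => hreal ψ ⟨hψ, hψt⟩) hφ).2 h⟩
  refine ⟨fun l v => x (l, v), fun k i j hi hj φ hφ => ?_, ?_⟩
  · cases k with
    | zero => rw [Subsingleton.elim i j]
    | succ r => rw [key r i hi φ hφ, key r j hj φ hφ]
  · obtain ⟨h, hmono, hh⟩ := hex 1
    refine ⟨h 0, h 1, hmono zero_lt_one, fun φ hφ => ?_⟩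
    rw [key 1 (fun l => l) (fun _ _ h => h) φ hφ, ← hh]
    have h2 : (fun v : Fin 2 × ι => t (![h 0, h 1] v.1) v.2) = fun v => t (h v.1) v.2 := by
      ext ⟨l, v⟩
      fin_cases l <;> rfl
    rw [h2]
    exact ⟨fun h => h.2, fun h => ⟨hφ, h⟩⟩

/-- Being pec does not include non-emptiness; here the inclusion into `U` reflects the positive
sentence `∃ x, ⊤`. -/
theorem IsPec.nonempty_substructure [Nonempty U] [U ⊨ T] {M : L.Substructure U} (hM : IsPec T M) :
    Nonempty M := by
  have := (hM.isImmersion M.subtype.toHom) 0 ((⊤ : L.Formula (Fin 0 ⊕ Fin 1)).iExs (Fin 1))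
    (IsPositive.top.iExs) Fin.elim0
  rw [Formula.realize_iExs, Formula.realize_iExs] at this
  obtain ⟨x, -⟩ := this.1 ⟨fun _ => Classical.arbitrary U, by simp⟩
  exact ⟨x 0⟩

/-- Over a sufficiently saturated pec substructure `M`, two tuples of the same type are second
members of indiscernible sequences with the same first member, up to finitely many conditions. -/
theorem IsMonster.exists_common_sequences [Nonempty U] (hU : IsMonster T κ U) (hκ : ℵ₀ < κ)
    {M : L.Substructure U} (hM : IsPec T M) (hMs : IsSaturated L (lambdaT T) M) {n k : ℕ}
    {a a' : Fin k → U} (haa' : SameType M a a') (m : Fin n → M)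
    (Θ₀ : Finset (L.Formula (ℕ × (Fin n ⊕ Fin k)))) (hpos : ∀ θ ∈ Θ₀, IsPositive θ)
    (hΘ₀ : ∀ d : ℕ → Fin n ⊕ Fin k → U, IsIndiscernibleFamily L d →
      ∀ θ ∈ Θ₀, θ.Realize fun v => d v.1 v.2) :
    ∃ Z Z' : ℕ × (Fin n ⊕ Fin k) → U, (∀ θ ∈ Θ₀, θ.Realize Z ∧ θ.Realize Z') ∧
      (∀ v, Z (0, v) = Z' (0, v)) ∧ (∀ v, Z (1, v) = Sum.elim (fun i => (m i : U)) a v) ∧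
      ∀ v, Z' (1, v) = Sum.elim (fun i => (m i : U)) a' v := by
  classical
  have := hU.pec.1
  have := hM.1
  have := hM.nonempty_substructure
  let I := (lambdaT T).ord.ToType
  let f : M →[L] U := M.subtype.toHom
  have hf : IsImmersion f := hM.isImmersion f
  -- By saturation of `M`, each `e i` in `M` has the type of `a` over `m` and the earlier members.
  obtain ⟨e, he⟩ := exists_wellFounded_choice (ι := I) (X := Fin k → M)
    (fun i g x => ∀ φ : L.Formula ((Fin n ⊕ (Set.Iio i × Fin k)) ⊕ Fin k), IsPositive φ →
      (φ.Realize (Sum.elim (f ∘ Sum.elim m fun v => g v.1 v.2) a) ↔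
        φ.Realize (Sum.elim (f ∘ Sum.elim m fun v => g v.1 v.2) (f ∘ x)))) (fun i g _ => by
    have hcard : #(Fin n ⊕ (Set.Iio i × Fin k)) < lambdaT T := by
      have hl := aleph0_le_lambdaT T
      have hi : #(Set.Iio i) < lambdaT T := by simpa [I] using mk_Iio_lt i (by simp [I])
      simp only [mk_sum, mk_prod, mk_fin, lift_natCast, lift_uzero]
      refine add_lt_of_lt hl (natCast_lt_aleph0.trans_le hl)
        (mul_lt_of_lt hl ?_ (natCast_lt_aleph0.trans_le hl))
      simpa using hi
    obtain ⟨x, hx⟩ := hMs.exists_realize_iff hM f (c := a) (hU.pec.isMaxTuple _) hcard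
      (Sum.elim m fun v => g v.1 v.2)
    refine ⟨x, fun φ hφ => (hx φ hφ).trans ?_⟩
    rw [← hf.realize_iff hφ, Sum.comp_elim])
  obtain ⟨d, hd, i, j, hij, hdij⟩ := hU.exists_indiscernible hκ (I := I) (mk_ord_toType _).ge
    fun i => Sum.elim (f ∘ m) (f ∘ e i)
  obtain ⟨θ, hθ, hθ'⟩ := exists_conj Θ₀ hpos
  -- `ξ` says that two tuples begin a sequence satisfying `Θ₀`. It passes from `(m, e i), (m, e j)`
  -- to `(m, e i), (m, a)` by the choice of `e j`, and then to `(m, e i), (m, a')` because `m` and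
  -- `e i` lie in `M`.
  obtain ⟨ξ, hξ, hξ'⟩ := exists_project (fun v : Fin 2 × (Fin n ⊕ Fin k) => ((v.1 : ℕ), v.2)) θ hθ
  have h0 : ξ.Realize fun v => d v.1 v.2 :=
    (hξ' U _).2 ⟨fun v => d v.1 v.2, rfl, (hθ' U _).2 (hΘ₀ d hd)⟩
  have h1 := (hdij ξ hξ).1 h0
  let pair : (Fin k → U) → Fin 2 × (Fin n ⊕ Fin k) → U := fun b v =>
    ![Sum.elim (f ∘ m) (f ∘ e i), Sum.elim (f ∘ m) b] v.1 v.2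
  have h2 : ξ.Realize (pair a) := by
    let r : Fin 2 × (Fin n ⊕ Fin k) → (Fin n ⊕ (Set.Iio j × Fin k)) ⊕ Fin k := fun v =>
      ![Sum.elim (fun l => Sum.inl (Sum.inl l)) (fun l => Sum.inl (Sum.inr (⟨i, hij⟩, l))),
        Sum.elim (fun l => Sum.inl (Sum.inl l)) Sum.inr] v.1 v.2
    have hr (b : Fin k → U) : Sum.elim (f ∘ Sum.elim m fun v : Set.Iio j × Fin k => e v.1 v.2) b ∘ r
        = pair b := by
      ext ⟨l, v | v⟩ <;> fin_cases l <;> rfl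
    have := he j (ξ.relabel r) (hξ.relabel r)
    rw [Formula.realize_relabel, Formula.realize_relabel, hr, hr] at this
    refine this.2 ?_
    convert h1 using 1
    ext ⟨l, v | v⟩ <;> fin_cases l <;> rfl
  have h3 : ξ.Realize (pair a') := by
    let r : Fin 2 × (Fin n ⊕ Fin k) → M ⊕ Fin k := fun v =>
      ![Sum.elim (fun l => Sum.inl (m l)) (fun l => Sum.inl (e i l)),
        Sum.elim (fun l => Sum.inl (m l)) Sum.inr] v.1 v.2
    have hr (b : Fin k → U) : Sum.elim (fun m : M => (m : U)) b ∘ r = pair b := by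
      ext ⟨l, v | v⟩ <;> fin_cases l <;> rfl
    have := haa' (ξ.relabel r) (hξ.relabel r)
    rw [Formula.realize_relabel, Formula.realize_relabel, hr, hr] at this
    exact this.1 h2
  obtain ⟨Z, hZ, hZθ⟩ := (hξ' U _).1 h2
  obtain ⟨Z', hZ', hZθ'⟩ := (hξ' U _).1 h3
  refine ⟨Z, Z', fun θ hθ => ⟨(hθ' U Z).1 hZθ θ hθ, (hθ' U Z').1 hZθ' θ hθ⟩, fun v => ?_,
    fun v => ?_, fun v => ?_⟩
  · exact (congrFun hZ (0, v)).trans (congrFun hZ' (0, v)).symm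
  · exact congrFun hZ (1, v)
  · exact congrFun hZ' (1, v)

end Coheir

/-! ### Invariance of negative coheirs -/

section CoheirInvariant

variable {L : FirstOrder.Language.{u, u}} {T : L.Theory} {κ : Cardinal.{u}}
  {U : Type u} [L.Structure U]

theorem SameType.symm {M : L.Substructure U} {k : ℕ} {a a' : Fin k → U} (h : SameType M a a') :
    SameType M a' a :=
  fun φ hφ => (h φ hφ).symm

/-- In thick theories negative coheirs over sufficiently saturated pec models are invariant. -/
theorem IsNegativeCoheir.isInvariant [Nonempty U] (hT : IsThick T) (hU : IsMonster T κ U)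
    (hκ : ℵ₀ < κ) {M : L.Substructure U} (hM : IsPec T M) (hMs : IsSaturated L (lambdaT T) M)
    {n : ℕ} {q : Set (L.Formula (U ⊕ Fin n))} (hq : q ∈ MaximalTypes T U n)
    (hco : IsNegativeCoheir T M q) : IsInvariant T M q := by
  classical
  suffices key : ∀ (k : ℕ) (a a' : Fin k → U), SameType M a a' →
      ∀ φ : L.Formula (Fin n ⊕ Fin k), IsPositive φ → plugFamily φ a ∈ q →
        plugFamily φ a' ∈ q by
    intro k a a' haa' φ hφ
    rw [MaximalTypes.entails_iff hq (φ := plug φ a) (hφ.relabel _),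
      MaximalTypes.entails_iff hq (φ := plug φ a') (hφ.relabel _)]
    exact ⟨key k a a' haa' φ hφ, key k a' a haa'.symm φ hφ⟩
  intro k a a' haa' φ hφ hφa
  by_contra hφa'
  let ι := Fin n ⊕ Fin k
  let P := Fin n ⊕ (Fin k ⊕ Fin k)
  let Γ := ι ⊕ ((ℕ × ι) ⊕ (ℕ × ι))
  -- `P` holds the variables `(x, y, y')` and `Γ` the quantified ones: a common first member and one
  -- block for each sequence. Index 0 reads the common member, index 1 reads `(x, y)` or `(x, y')`,
  -- and later indices read the block.
  let r (s : ι → P) (w : ℕ × ι → Γ) : ℕ × ι → P ⊕ Γ := fun v =>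
    if v.1 = 0 then Sum.inr (Sum.inl v.2) else if v.1 = 1 then Sum.inl (s v.2) else Sum.inr (w v)
  let r₁ := r (Sum.map id Sum.inl) fun v => Sum.inr (Sum.inl v)
  let r₂ := r (Sum.map id Sum.inr) fun v => Sum.inr (Sum.inr v)
  obtain ⟨Θ, hΘ, hΘind⟩ := hT.exists_definition hU.pec ι
  let S : Set (L.Formula (P ⊕ Γ)) :=
    {ψ | ∃ θ ∈ Θ, ψ = θ.relabel r₁ ∨ ψ = θ.relabel r₂}
  have hS (ψ) (h : ψ ∈ S) : IsPositive ψ := by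
    obtain ⟨θ, hθ, rfl | rfl⟩ := h <;> exact (hΘ θ hθ).relabel _
  -- If every finite part belonged to `q`, saturation would give both sequences at a realisation `x`
  -- of `q`, and `φ` would pass from `(x, a)` through the common first member to `(x, a')`.
  obtain ⟨S₀, hS₀, χ, hχ, hχS, hχq⟩ : ∃ S₀ : Finset (L.Formula (P ⊕ Γ)), (∀ ψ ∈ S₀, ψ ∈ S) ∧
      ∃ χ : L.Formula P, IsPositive χ ∧ (∀ w : P → U, χ.Realize w ↔
        ∃ u : Γ → U, ∀ ψ ∈ S₀, ψ.Realize (Sum.elim w u)) ∧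
        plugFamily χ (Sum.elim a a') ∉ q := by
    by_contra! hcon
    obtain ⟨x, hx⟩ := hU.exists_realizesOver hq (Set.range (Sum.elim a a'))
      ((Set.finite_range _).lt_aleph0.trans hκ)
    obtain ⟨u, hu⟩ := hU.saturated.satisfiable_countable hU.pec hκ
      (Sum.elim x (Sum.elim a a') : P → U) S hS (fun S₀ hS₀ => by
        obtain ⟨ψ, hψ, hψS⟩ := exists_conj S₀ fun φ hφ => hS φ (hS₀ hφ)
        obtain ⟨χ, hχ, hχψ⟩ := exists_project (Sum.inl : P → P ⊕ Γ) ψ hψ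
        have hχ' (w : P → U) : χ.Realize w ↔
            ∃ u : Γ → U, ∀ ψ ∈ S₀, ψ.Realize (Sum.elim w u) := by
          rw [hχψ]
          constructor
          · rintro ⟨u, rfl, hu⟩
            refine ⟨u ∘ Sum.inr, ?_⟩
            rw [Sum.elim_comp_inl_inr]
            exact (hψS U u).1 hu
          · rintro ⟨u, hu⟩
            exact ⟨Sum.elim w u, Sum.elim_comp_inl _ _, (hψS U _).2 hu⟩
        have := hcon S₀ (fun ψ hψ => hS₀ hψ) χ hχ hχ'
        rw [hx.mem_iff hq (fun i => ⟨i, rfl⟩) χ hχ] at this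
        exact (hχ' _).1 this)
    let Z (s : ι → P) (w : ℕ × ι → Γ) : ℕ → ι → U := fun i v =>
      Sum.elim (Sum.elim x (Sum.elim a a') : P → U) u (r s w (i, v))
    have hZ₁ : IsIndiscernibleFamily L (Z (Sum.map id Sum.inl) fun v => Sum.inr (Sum.inl v)) :=
      (hΘind _).2 fun θ hθ => by
        have := hu _ ⟨θ, hθ, Or.inl rfl⟩
        rwa [Formula.realize_relabel] at this
    have hZ₂ : IsIndiscernibleFamily L (Z (Sum.map id Sum.inr) fun v => Sum.inr (Sum.inr v)) :=
      (hΘind _).2 fun θ hθ => by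
        have := hu _ ⟨θ, hθ, Or.inr rfl⟩
        rwa [Formula.realize_relabel] at this
    have h1 := hZ₁.realize_iff φ hφ 0 1
    have h2 := hZ₂.realize_iff φ hφ 0 1
    have e0 : Z (Sum.map id Sum.inl) (fun v => Sum.inr (Sum.inl v)) 0 =
        Z (Sum.map id Sum.inr) (fun v => Sum.inr (Sum.inr v)) 0 := rfl
    have e1 : Z (Sum.map id Sum.inl) (fun v => Sum.inr (Sum.inl v)) 1 = Sum.elim x a := by
      ext (v | v) <;> rfl
    have e2 : Z (Sum.map id Sum.inr) (fun v => Sum.inr (Sum.inr v)) 1 = Sum.elim x a' := by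
      ext (v | v) <;> rfl
    rw [e1] at h1
    rw [e2, ← e0, h1] at h2
    have ha := hx.mem_iff hq (b := a) (fun i => ⟨Sum.inl i, rfl⟩) φ hφ
    have ha' := hx.mem_iff hq (b := a') (fun i => ⟨Sum.inr i, rfl⟩) φ hφ
    exact hφa' (ha'.2 (h2.1 (ha.1 hφa)))
  -- The negation of `χ` follows from `q`, so it holds at some `m` in `M`, where the common
  -- sequences contradict it.
  obtain ⟨m, hm⟩ := hco _ (hχ.relabel _) (MaximalTypes.entails_not hq (hχ.relabel _) hχq)
  refine hm ((realize_plugFamily χ (Sum.elim a a') id _).2 ((hχS _).2 ?_))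
  choose! θ hθ hθψ using hS₀
  obtain ⟨Z, Z', hZ, h0, h1, h1'⟩ := hU.exists_common_sequences hκ hM hMs haa' m (S₀.image θ)
    (fun φ hφ => by
      obtain ⟨ψ, hψ, rfl⟩ := Finset.mem_image.1 hφ
      exact hΘ _ (hθ ψ hψ))
    (fun d hd φ hφ => by
      obtain ⟨ψ, hψ, rfl⟩ := Finset.mem_image.1 hφ
      exact (hΘind d).1 hd _ (hθ ψ hψ))
  refine ⟨Sum.elim (fun v => Z (0, v)) (Sum.elim Z Z'), fun ψ hψ => ?_⟩
  have hθZ := hZ _ (Finset.mem_image_of_mem θ hψ)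
  rcases hθψ ψ hψ with h | h
  · rw [h, Formula.realize_relabel]
    convert hθZ.1 using 1
    ext ⟨i, v⟩
    match i, v with
    | 0, v => rfl
    | 1, Sum.inl v => exact (h1 (Sum.inl v)).symm
    | 1, Sum.inr v => exact (h1 (Sum.inr v)).symm
    | i + 2, v => rfl
  · rw [h, Formula.realize_relabel]
    convert hθZ.2 using 1
    ext ⟨i, v⟩
    match i, v with
    | 0, v => exact h0 v
    | 1, Sum.inl v => exact (h1' (Sum.inl v)).symm
    | 1, Sum.inr v => exact (h1' (Sum.inr v)).symm
    | i + 2, v => rfl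

end CoheirInvariant

/-! ### Small saturated pec substructures -/

section SmallModels

variable {L : FirstOrder.Language.{u, u}} {T : L.Theory} {κ : Cardinal.{u}}
  {U : Type u} [L.Structure U]

/-- Small sets are contained in small sets that realise every type over few parameters which is
realised in the whole structure. -/
theorem exists_witness_closed_set [Nonempty U] {ν : Cardinal.{u}} (hν : ℵ₀ ≤ ν) (hL : L.card ≤ ν)
    (X₀ : Set U) (hX₀ : #X₀ ≤ 2 ^ ν) :
    ∃ Y : Set U, X₀ ⊆ Y ∧ #Y ≤ 2 ^ ν ∧ ∀ (β : Type u), #β ≤ ν → ∀ (b : β → U), (∀ i, b i ∈ Y) →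
      ∀ (n : ℕ) (S : Set (L.Formula (β ⊕ Fin n))),
        (∃ x : Fin n → U, ∀ φ ∈ S, φ.Realize (Sum.elim b x)) →
        ∃ x : Fin n → U, (∀ i, x i ∈ Y) ∧ ∀ φ ∈ S, φ.Realize (Sum.elim b x) := by
  classical
  let τ : Type u := ν.out
  have hτ : #τ = ν := mk_out ν
  have : Infinite τ := by rw [infinite_iff, hτ]; exact hν
  have h2 : ℵ₀ ≤ (2 : Cardinal.{u}) ^ ν := hν.trans (cantor _).le
  let O := Set (L.Formula (τ ⊕ ℕ)) × ℕ
  have hO : #O ≤ 2 ^ #τ := by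
    have hF : #(L.Formula (τ ⊕ ℕ)) ≤ ν := by
      refine (card_formula_le _).trans (max_le hν (add_le_of_le hν ?_ hL))
      simp only [mk_sum, lift_uzero, hτ, mk_nat, lift_aleph0]
      exact add_le_of_le hν (by simp) hν
    simp only [O, mk_prod, lift_uzero, mk_nat, lift_aleph0, mk_set, hτ]
    exact mul_le_of_le h2 (by simpa using power_le_power_left two_ne_zero hF) h2
  -- An operation returns one coordinate of a chosen solution of a set of formulas over `τ`
  -- parameters. The `ℕ` variables serve all finite arities at once.
  let op : O → (τ → U) → U := fun o z =>
    if h : ∃ x : ℕ → U, ∀ φ ∈ o.1, φ.Realize (Sum.elim z x) then h.choose o.2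
    else Classical.arbitrary U
  obtain ⟨Y, hY, hYcard, hYop⟩ := exists_closed_set hO op (insert (Classical.arbitrary U) X₀) (by
    rw [hτ]
    exact mk_insert_le.trans (add_le_of_le h2 hX₀ (one_le_aleph0.trans h2)))
  rw [hτ] at hYcard
  refine ⟨Y, (Set.subset_insert _ _).trans hY, hYcard, fun β hβ b hb n S hS => ?_⟩
  obtain ⟨e⟩ : Nonempty (β ↪ τ) := by rw [← Cardinal.le_def, hτ]; exact hβ
  let z : τ → U := Function.extend e b fun _ => Classical.arbitrary U
  have hze (i : β) : z (e i) = b i := e.injective.extend_apply _ _ _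
  have hzY (i : τ) : z i ∈ Y := by
    by_cases hi : ∃ j, e j = i
    · obtain ⟨j, rfl⟩ := hi
      rw [hze]
      exact hb j
    · simp only [z, Function.extend_apply' _ _ _ hi]
      exact hY (Set.mem_insert _ _)
  let r : β ⊕ Fin n → τ ⊕ ℕ := Sum.map e fun i => i
  have hr (y : ℕ → U) : Sum.elim z y ∘ r = Sum.elim b fun i : Fin n => y i := by
    ext (i | i)
    · exact hze i
    · rfl
  let S' : Set (L.Formula (τ ⊕ ℕ)) := (fun φ => φ.relabel r) '' S
  have hex : ∃ y : ℕ → U, ∀ φ ∈ S', φ.Realize (Sum.elim z y) := by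
    obtain ⟨x, hx⟩ := hS
    refine ⟨fun i => if h : i < n then x ⟨i, h⟩ else Classical.arbitrary U, ?_⟩
    rintro _ ⟨φ, hφ, rfl⟩
    rw [Formula.realize_relabel, hr]
    simpa using hx φ hφ
  refine ⟨fun i => hex.choose i, fun i => ?_, fun φ hφ => ?_⟩
  · have := hYop (S', i) z hzY
    simpa only [op, dif_pos hex] using this
  · have := hex.choose_spec _ ⟨φ, hφ, rfl⟩
    rwa [Formula.realize_relabel, hr] at this

/-- A model immersed in a pec model is pec. -/
theorem IsPec.of_immersion [Nonempty U] (hU : IsPec T U) {M : Type u} [L.Structure M] [M ⊨ T]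
    (f : M →[L] U) (hf : IsImmersion f) : IsPec T M := by
  refine ⟨‹_›, fun A g k φ hφ a => ⟨fun h => ?_, fun h => hφ.realize_formula_hom g h⟩⟩
  by_contra hn
  rw [← hf k φ hφ a] at hn
  obtain ⟨ψ, hψ, hψa, hcon⟩ := (hU.isMaxTuple (f ∘ a)).separate hφ hn
  exact hcon A _ h (hψ.realize_formula_hom g ((hf k ψ hψ a).1 hψa))

/-- The witness-closed set suffices: applied to graphs of functions, closure gives a substructure;
applied to single first-order formulas, the Tarski–Vaught test; applied to sets of positive formulas
over few parameters, saturation. -/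
theorem IsMonster.exists_small_saturated [Nonempty U] (hU : IsMonster T κ U) {ν : Cardinal.{u}}
    (hν : ℵ₀ ≤ ν) (hνκ : ν ≤ κ) (hL : L.card ≤ ν) (X₀ : Set U) (hX₀ : #X₀ ≤ 2 ^ ν) :
    ∃ M : L.Substructure U, X₀ ⊆ M ∧ #M ≤ 2 ^ ν ∧ IsPec T M ∧ IsSaturated L ν M := by
  have := hU.pec.1
  obtain ⟨Y, hXY, hYcard, hY⟩ := exists_witness_closed_set hν hL X₀ hX₀
  have hfin (k : ℕ) : #(ULift.{u} (Fin k)) ≤ ν := by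
    simpa using (natCast_le_aleph0 (n := k)).trans hν
  let M : L.Substructure U := ⟨Y, fun {k} F x hx => by
    obtain ⟨y, hyY, hy⟩ := hY (ULift.{u} (Fin k)) (hfin k) (fun i => x i.down)
      (fun i => hx i.down) 1
      {(Term.var (Sum.inr 0)).equal (Term.func F fun i => Term.var (Sum.inl ⟨i⟩))}
      ⟨fun _ => Structure.funMap F x, by simp⟩
    have := hy _ rfl
    simp only [Formula.realize_equal, Term.realize_var, Sum.elim_inr, Term.realize_func,
      Sum.elim_inl] at this
    rw [← this]
    exact hyY 0⟩
  have hel : M.IsElementary := by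
    refine Substructure.isElementary_of_exists M fun k φ x a h => ?_
    let r : Empty ⊕ Fin (k + 1) → ULift.{u} (Fin k) ⊕ Fin 1 := Sum.elim Empty.elim
      fun i => Fin.lastCases (motive := fun _ => ULift.{u} (Fin k) ⊕ Fin 1) (Sum.inr 0)
        (fun l => Sum.inl ⟨l⟩) i
    have hr (b : U) : (φ.toFormula.relabel r).Realize
        (Sum.elim (fun i : ULift.{u} (Fin k) => (x i.down : U)) fun _ : Fin 1 => b) ↔
        φ.Realize default (Fin.snoc ((↑) ∘ x) b) := by
      rw [Formula.realize_relabel, BoundedFormula.realize_toFormula]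
      refine iff_of_eq ?_
      congr 1
      · exact Subsingleton.elim _ _
      · ext i
        refine Fin.lastCases ?_ (fun l => ?_) i <;> simp [r]
    obtain ⟨y, hyY, hy⟩ := hY (ULift.{u} (Fin k)) (hfin k) (fun i => x i.down)
      (fun i => (x i.down).2) 1 {φ.toFormula.relabel r} ⟨fun _ => a, by
        rintro _ rfl
        exact (hr a).2 h⟩
    refine ⟨⟨y 0, hyY 0⟩, (hr (y 0)).1 ?_⟩
    convert hy _ rfl using 3 with i
    rw [Subsingleton.elim i 0]
  have hf : IsImmersion M.subtype.toHom := fun k φ _ a => hel φ a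
  have hMT : M ⊨ T := by
    refine (Theory.model_iff _).2 fun σ hσ => ?_
    have h1 : U ⊨ σ := Theory.realize_sentence_of_mem T hσ
    have h2 : Formula.Realize σ (default : Empty → U) ↔ Formula.Realize σ (default : Empty → M) := by
      have := hel (Formula.relabel (Empty.elim : Empty → Fin 0) σ) Fin.elim0
      rw [Formula.realize_relabel, Formula.realize_relabel] at this
      convert this
    exact h2.1 h1
  refine ⟨M, hXY, hYcard, hU.pec.of_immersion _ hf, fun A hA n S hS hfinS => ?_⟩
  have hcoe (x : Fin n → M) : M.subtype.toHom ∘ Sum.elim (fun a : A => (a : M)) x =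
      Sum.elim (fun a : A => ((a : M) : U)) fun i => (x i : U) := by
    ext (i | i) <;> rfl
  obtain ⟨x, hx⟩ := hU.saturated.satisfiable (hA.trans_le hνκ) (fun a : A => ((a : M) : U)) S hS
    fun S₀ hS₀ => by
      obtain ⟨x, hx⟩ := hfinS S₀ hS₀
      refine ⟨fun i => x i, fun φ hφ => ?_⟩
      rw [← hcoe, hf.realize_iff (hS φ (hS₀ hφ))]
      exact hx φ hφ
  obtain ⟨y, hyY, hy⟩ := hY A hA.le _ (fun a => (a : M).2) n S ⟨x, hx⟩
  refine ⟨fun i => ⟨y i, hyY i⟩, fun φ hφ => ?_⟩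
  rw [← hf.realize_iff (hS φ hφ), hcoe]
  exact hy φ hφ

end SmallModels

/-! ### The independence property produces many negative coheirs -/

section IP

variable {L : FirstOrder.Language.{u, u}} {T : L.Theory} {κ : Cardinal.{u}}
  {U : Type u} [L.Structure U]

/-- The independence property is witnessed in a monster model on every small index set. -/
theorem IsMonster.exists_independent_family [Nonempty U] (hU : IsMonster T κ U) (hκ : ℵ₀ ≤ κ)
    (hJCP : HasJCP T) {n k : ℕ} {φ ψ : L.Formula (Fin n ⊕ Fin k)} (hφ : IsPositive φ)
    (hψ : IsPositive ψ) {A : Theory.ModelType.{u, u, u} T} {a : ℕ → Fin n → A}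
    {b : Set ℕ → Fin k → A}
    (hab : ∀ (i : ℕ) (W : Set ℕ), (i ∈ W → φ.Realize (Sum.elim (a i) (b W))) ∧
      (i ∉ W → ψ.Realize (Sum.elim (a i) (b W)))) {J : Type u} (hJ : #J < κ) :
    ∃ (c : J → Fin n → U) (d : Set J → Fin k → U), ∀ (j : J) (W : Set J),
      (j ∈ W → φ.Realize (Sum.elim (c j) (d W))) ∧
      (j ∉ W → ψ.Realize (Sum.elim (c j) (d W))) := by
  classical
  have := hU.pec.1
  let θ (W : Set J) (j : J) : L.Formula (Fin n ⊕ Fin k) := if j ∈ W then φ else ψ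
  have hθ (W : Set J) (j : J) : IsPositive (θ W j) := by
    simp only [θ]; split_ifs <;> assumption
  have hconj (t : Finset J) (W : Set J) : ∃ E : L.Formula (J × Fin n), IsPositive E ∧
      ∀ (B : Type u) [L.Structure B] (x : J × Fin n → B),
        E.Realize x ↔ ∃ y : Fin k → B, ∀ j ∈ t,
          (θ W j).Realize (Sum.elim (fun i => x (j, i)) y) := by
    obtain ⟨χ, hχ, hχ'⟩ := exists_conj
      (t.image fun j => (θ W j).relabel (Sum.map (fun i => (j, i)) id : _ → (J × Fin n) ⊕ Fin k))
      (by
        simp only [Finset.mem_image, forall_exists_index, and_imp, forall_apply_eq_imp_iff₂]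
        exact fun j _ => (hθ W j).relabel _)
    refine ⟨χ.iExs (Fin k), hχ.iExs, fun B _ x => ?_⟩
    rw [Formula.realize_iExs]
    refine exists_congr fun y => ?_
    rw [hχ', Finset.forall_mem_image]
    refine forall₂_congr fun j _ => ?_
    rw [Formula.realize_relabel]
    refine iff_of_eq (congrArg _ ?_)
    ext (i | i) <;> rfl
  choose E hE hE' using hconj
  -- `E t W` says that some tuple realises the pattern `W` on the finite set `t`. Finitely many such
  -- formulas involve finitely many indices, which embed in `ℕ`, where the given family realises all
  -- patterns.
  have hcons : Consistent T {χ | ∃ t W, χ = E t W} := by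
    refine consistent_of_finite fun s hs => ?_
    have hs' : ∀ χ ∈ s, ∃ t W, χ = E t W := fun χ hχ => hs hχ
    choose! t W htW using hs'
    obtain ⟨e⟩ : Nonempty ((s.biUnion t : Finset J) ↪ ℕ) :=
      ⟨(Finite.equivFin _).toEmbedding.trans Fin.valEmbedding⟩
    let g : J → ℕ := fun j => if h : j ∈ s.biUnion t then e ⟨j, h⟩ else 0
    refine ⟨A, fun v => a (g v.1) v.2, fun χ hχ => ?_⟩
    rw [htW χ hχ, hE']
    refine ⟨b {i | ∃ j, ∃ h : j ∈ s.biUnion t, e ⟨j, h⟩ = i ∧ j ∈ W χ}, fun j hj => ?_⟩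
    have hjt : j ∈ s.biUnion t := Finset.mem_biUnion.2 ⟨χ, hχ, hj⟩
    have hg : g j = e ⟨j, hjt⟩ := dif_pos hjt
    have hmem : g j ∈ {i | ∃ j, ∃ h : j ∈ s.biUnion t, e ⟨j, h⟩ = i ∧ j ∈ W χ} ↔ j ∈ W χ := by
      rw [hg]
      constructor
      · rintro ⟨j', h', hej, hW⟩
        have := congrArg Subtype.val (e.injective hej)
        simp only at this
        rwa [← this]
      · exact fun h => ⟨j, hjt, rfl, h⟩
    simp only [θ]
    split_ifs with h
    · exact (hab _ _).1 (hmem.2 h)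
    · exact (hab _ _).2 (mt hmem.1 h)
  obtain ⟨A', v, hv⟩ := hcons
  -- Joint continuation brings a family found in an unrelated model into a continuation of `U`, from
  -- which saturation copies it.
  obtain ⟨B, ⟨f⟩, ⟨g⟩⟩ := hJCP A' (Theory.ModelType.of T U)
  have hcard : #(J × Fin n) < κ := by
    rw [mk_prod, lift_id']
    simpa using mul_lt_of_lt hκ hJ (natCast_lt_aleph0.trans_le hκ)
  obtain ⟨c, hc⟩ := hU.saturated.exists_copy (A := B) hκ g (hU.pec.isImmersion (U := U) g)
    (β := PEmpty.{u + 1}) (by simpa using aleph0_pos.trans_le hκ) hcard PEmpty.elim (f ∘ v)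
  have hcE (t : Finset J) (W : Set J) : (E t W).Realize c := by
    have := hc ((E t W).relabel Sum.inr) ((hE t W).relabel _) (by
      rw [Formula.realize_relabel, Sum.elim_comp_inr]
      exact (hE t W).realize_formula_hom f (hv _ ⟨t, W, rfl⟩))
    rwa [Formula.realize_relabel, Sum.elim_comp_inr] at this
  choose d hd using fun W : Set J => hU.saturated.exists_solution hκ hJ
    (fun j i => c (j, i)) (θ W) (hθ W) fun t => (hE' t W U c).1 (hcE t W)
  refine ⟨fun j i => c (j, i), d, fun j W => ⟨fun h => ?_, fun h => ?_⟩⟩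
  · have := hd W j
    rwa [show θ W j = φ from if_pos h] at this
  · have := hd W j
    rwa [show θ W j = ψ from if_neg h] at this

/-- An ultrafilter on a family of tuples of `M` gives rise to a global negative coheir. -/
theorem exists_negativeCoheir [Nonempty U] [U ⊨ T] {M : L.Substructure U} {n : ℕ} {J : Type u}
    (a : J → Fin n → U) (haM : ∀ j i, a j i ∈ M) (D : Ultrafilter J) :
    ∃ q ∈ MaximalTypes T U n, IsNegativeCoheir T M q ∧
      ∀ χ : L.Formula (U ⊕ Fin n), IsPositive χ →
        (∀ᶠ j in (D : Filter J), χ.Realize (Sum.elim id (a j))) → χ ∈ q := by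
  classical
  let q₀ : Set (L.Formula (U ⊕ Fin n)) :=
    {χ | IsPositive χ ∧ ∀ᶠ j in (D : Filter J), χ.Realize (Sum.elim id (a j))}
  have hdiag (χ : L.Formula U) (hχ : IsPositive χ) (h : χ.Realize (id : U → U)) :
      χ.relabel Sum.inl ∈ q₀ :=
    ⟨hχ.relabel _, .of_forall fun j => by
      rw [Formula.realize_relabel, Sum.elim_comp_inl]; exact h⟩
  have hcons : Consistent T q₀ := by
    refine consistent_of_finite fun s hs => ?_
    obtain ⟨j, hj⟩ := ((Finset.eventually_all s).2 fun χ hχ => (hs hχ).2).exists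
    exact ⟨Theory.ModelType.of T U, Sum.elim id (a j), hj⟩
  obtain ⟨A, v, hv⟩ := hcons
  obtain ⟨f, hf⟩ := exists_hom_of_preserves (v ∘ Sum.inl) fun χ hχ (h : χ.Realize (id : U → U)) => by
    simpa using hv _ (hdiag χ hχ h)
  obtain ⟨q, hq, hq₀⟩ := IsPartialType.exists_maximal (T := T) (p := q₀)
    ⟨fun χ h => h.1, A, f, v ∘ Sum.inr, fun χ hχ => by
      rw [hf, Sum.elim_comp_inl_inr]; exact hv χ hχ⟩
  refine ⟨q, hq, fun χ hχ hent => ?_, fun χ hχ h => hq₀ ⟨hχ, h⟩⟩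
  -- A formula true throughout `M` holds at every `a j`, hence belongs to `q`, and its negation
  -- cannot follow from `q`.
  by_contra! hcon
  obtain ⟨B, g, c, -, hmem⟩ := exists_realization hq
  have hχq : χ ∈ q := hq₀ ⟨hχ, .of_forall fun j => hcon fun i => ⟨a j i, haM j i⟩⟩
  have := hent B g c fun φ hφ => ((hmem φ).1 hφ).2
  rw [Formula.realize_not] at this
  exact this ((hmem χ).1 hχq).2

/-- Every global type extends a maximal type over each pec substructure. -/
theorem MaximalTypes.exists_restriction {M : L.Substructure U} {n : ℕ}
    {q : Set (L.Formula (U ⊕ Fin n))} (hq : q ∈ MaximalTypes T U n) :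
    ∃ p ∈ MaximalTypes T M n, Extends q p := by
  obtain ⟨A, f, c, hmax, hmem⟩ := exists_realization hq
  refine ⟨_, IsMaxTuple.mem_maximalTypes (f.comp M.subtype.toHom) c ?_, fun φ hφ => ?_⟩
  · convert hmax.comp (Sum.map (fun m : M => (m : U)) id) using 1
    ext (i | i) <;> rfl
  · refine (hmem _).2 ⟨hφ.1.relabel _, ?_⟩
    rw [Formula.realize_relabel]
    convert hφ.2 using 1
    ext (i | i) <;> rfl

/-- A shattered family of size `2 ^ λ_T` inside a saturated `M` no larger than itself turns the `2 ^
2 ^ |J|` independent ultrafilters into distinct negative coheirs. Since types over `M` are few, the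
assumed bound allows only `2 ^ |J|` of them in total. -/
theorem isNIP_of_card_negativeCoheirExtensions_le [Nonempty U] (hU : IsMonster T κ U)
    (hκ : (2 : Cardinal.{u}) ^ lambdaT T < κ) (hJCP : HasJCP T)
    (h : ∀ M : L.Substructure U, #M < κ → IsPec T M → IsSaturated L (lambdaT T) M →
      ∀ (n : ℕ), ∀ p ∈ MaximalTypes T M n,
        #(negativeCoheirExtensions T M p) ≤ 2 ^ (#M + theoryCard T)) : IsNIP T := by
  classical
  intro n k φ hφ ⟨ψ, hψ, hcon, A, a, b, hab⟩
  have := hU.pec.1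
  have hl := aleph0_le_lambdaT T
  have hlκ : lambdaT T < κ := (cantor _).trans hκ
  have hTl : theoryCard T ≤ lambdaT T := ((cantor _).trans (theoryCard_lt_lambdaT T)).le
  let J : Type u := ((2 : Cardinal.{u}) ^ lambdaT T).out
  have hJ : #J = 2 ^ lambdaT T := mk_out _
  have hJ0 : ℵ₀ ≤ #J := by rw [hJ]; exact hl.trans (cantor _).le
  have : Infinite J := infinite_iff.2 hJ0
  obtain ⟨c, d, hcd⟩ := hU.exists_independent_family (hl.trans hlκ.le) hJCP hφ hψ hab
    (J := J) (by rwa [hJ])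
  obtain ⟨M, hcM, hMcard, hMpec, hMs⟩ := hU.exists_small_saturated hl hlκ.le
    ((le_max_right _ _).trans hTl) (Set.range fun v : J × Fin n => c v.1 v.2) (by
      refine mk_range_le.trans ?_
      rw [mk_prod, lift_id', ← hJ]
      simpa using mul_le_of_le hJ0 le_rfl (natCast_le_aleph0.trans hJ0))
  obtain ⟨W, D, hWD⟩ := exists_independent_ultrafilters J
  choose q hq hqco hqD using fun Z => exists_negativeCoheir (T := T) (M := M) c
    (fun j i => hcM ⟨(j, i), rfl⟩) (D Z)
  choose p hp hqp using fun Z => MaximalTypes.exists_restriction (M := M) (hq Z)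
  have hin (Z : Set (Set J)) (X : Set J) (hX : X ∈ Z) : plugFamily φ (d (W X)) ∈ q Z := by
    refine hqD Z _ (hφ.relabel _) (Filter.mem_of_superset ((hWD Z X).1 hX) fun j hj => ?_)
    exact (realize_plugFamily _ _ _ _).2 ((hcd j _).1 hj)
  have hout (Z : Set (Set J)) (X : Set J) (hX : X ∉ Z) : plugFamily ψ (d (W X)) ∈ q Z := by
    refine hqD Z _ (hψ.relabel _) (Filter.mem_of_superset ((hWD Z X).2 hX) fun j hj => ?_)
    exact (realize_plugFamily _ _ _ _).2 ((hcd j _).2 hj)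
  have hdisj (Z Z' : Set (Set J)) (hZZ' : q Z = q Z') : Z ⊆ Z' := by
    intro X hX
    by_contra hX'
    obtain ⟨B, f, x, -, hmem⟩ := exists_realization (hq Z)
    have h1 := ((hmem _).1 (hin Z X hX)).2
    have h2 := ((hmem _).1 (hZZ' ▸ hout Z' X hX')).2
    rw [realize_plugFamily] at h1 h2
    exact hcon B _ _ ⟨h1, h2⟩
  have hMT : #M + theoryCard T ≤ #J :=
    add_le_of_le hJ0 (hMcard.trans_eq hJ.symm) (hTl.trans ((cantor _).le.trans_eq hJ.symm))
  -- The coheirs need not extend the same type over `M`, so each is counted together with its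
  -- restriction.
  let F : Set (Set J) → Σ p : MaximalTypes T M n, negativeCoheirExtensions T M p.1 :=
    fun Z => ⟨⟨p Z, hp Z⟩, ⟨q Z, hq Z, hqp Z, hqco Z⟩⟩
  have hF : Function.Injective F := by
    intro Z Z' hZ
    have hqq : q Z = q Z' := congrArg (fun s => s.2.1) hZ
    exact (hdisj Z Z' hqq).antisymm (hdisj Z' Z hqq.symm)
  have h2 : ℵ₀ ≤ (2 : Cardinal.{u}) ^ #J := hJ0.trans (cantor _).le
  have hle : (2 : Cardinal.{u}) ^ ((2 : Cardinal.{u}) ^ #J) ≤ 2 ^ #J := by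
    rw [← mk_set, ← mk_set]
    refine (mk_le_of_injective hF).trans ?_
    rw [mk_sigma]
    refine (sum_le_mk_mul_iSup _).trans ?_
    rw [mk_set]
    refine mul_le_of_le h2 ?_ (ciSup_le' fun p' => ?_)
    · refine (mk_subtype_le _).trans ?_
      rw [mk_set]
      refine power_le_power_left two_ne_zero (le_trans ?_ hMT)
      refine (card_formula_le _).trans (max_le ?_ ?_)
      · exact (aleph0_le_theoryCard T).trans (self_le_add_left _ _)
      · simp only [mk_sum, mk_fin, lift_uzero, lift_natCast, add_assoc]
        gcongr
        exact add_le_of_le (aleph0_le_theoryCard T)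
          (natCast_le_aleph0.trans (aleph0_le_theoryCard T)) (le_max_right _ _)
    · exact (h M (hMcard.trans_lt hκ) hMpec hMs n p'.1 p'.2).trans
        (power_le_power_left two_ne_zero hMT)
  exact hle.not_gt (cantor _)

end IP

end PositiveLogic

theorem mainTheorem6 {L : FirstOrder.Language.{u, u}} (T : L.Theory)
    (hT : PositiveLogic.IsPositiveTheory T) (hJCP : PositiveLogic.HasJCP T)
    (hthick : PositiveLogic.IsThick T)
    (κ : Cardinal.{u}) (hκ : (2 : Cardinal.{u}) ^ PositiveLogic.lambdaT T < κ)
    (U : Type u) [L.Structure U] [Nonempty U] (hU : PositiveLogic.IsMonster T κ U) :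
    List.TFAE [
      PositiveLogic.IsNIP T,
      ∀ M : L.Substructure U, Cardinal.mk M < κ → PositiveLogic.IsPec T M →
        ∀ (n : ℕ), ∀ p ∈ PositiveLogic.MaximalTypes T M n,
          Cardinal.mk (PositiveLogic.invariantExtensions T M p) ≤
            2 ^ (Cardinal.mk M + PositiveLogic.theoryCard T),
      ∀ M : L.Substructure U, Cardinal.mk M < κ → PositiveLogic.IsPec T M →
        PositiveLogic.IsSaturated L (PositiveLogic.lambdaT T) M →
        ∀ (n : ℕ), ∀ p ∈ PositiveLogic.MaximalTypes T M n,
          Cardinal.mk (PositiveLogic.negativeCoheirExtensions T M p) ≤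
            2 ^ (Cardinal.mk M + PositiveLogic.theoryCard T)] := by
  have hκ₀ : Cardinal.aleph0 < κ :=
    (PositiveLogic.aleph0_le_lambdaT T).trans_lt ((Cardinal.cantor _).trans hκ)
  tfae_have 1 → 2 := fun h M hM _ n p _ => h.card_invariantExtensions_le hU hκ₀ hM p
  tfae_have 2 → 3 := by
    intro h M hM hpec hsat n p hp
    have hsub : PositiveLogic.negativeCoheirExtensions T M p ⊆
        PositiveLogic.invariantExtensions T M p := fun q hq =>
      ⟨hq.1, hq.2.1, hq.2.2.isInvariant hthick hU hκ₀ hpec hsat hq.1⟩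
    exact (Cardinal.mk_le_mk_of_subset hsub).trans (h M hM hpec n p hp)
  tfae_have 3 → 1 := PositiveLogic.isNIP_of_card_negativeCoheirExtensions_le hU hκ hJCP
  tfae_finish
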